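/- Let $d,r,N\ge 1$ be integers, $1<p,q<\infty$, $K_1,K_2>0$ and $C_K=[-K_1,K_1]\times[-K_2,K_2]^d\subset\mathbb R\times\mathbb R^d$. For complex-valued $f$ on $\mathbb R\times\mathbb R^d$ put $\|f\|_{L^{p,q}}=\big(\int_{\mathbb R}(\int_{\mathbb R^d}|f(x,y)|^q\,dy)^{p/q}dx\big)^{1/p}$, and for $c=(c(k_1,k_2))_{k_1\in\mathbb Z,k_2\in\mathbb Z^d}$ put $\|c\|_{l^{p,q}}=\big(\sum_{k_1}(\sum_{k_2}|c(k_1,k_2)|^q)^{p/q}\big)^{1/p}$. Write $|y|$ for the Euclidean norm of $y\in\mathbb R^d$ and $|k|=\max_i|k_i|$ for $k\in\mathbb Z^d$. Assume: (A1) $\phi_1,\dots,\phi_r:\mathbb R\times\mathbb R^d\to\mathbb C$ are continuous; there are $\alpha_1,\alpha_2>0$ such that, for all $c_1,\dots,c_r\in l^{p,q}(\mathbb Z\times\mathbb Z^d)$, $$\alpha_1\sum_{i=1}^r\|c_i\|_{l^{p,q}}\le\Big\|\sum_{k_1\in\mathbb Z}\sum_{k_2\in\mathbb Z^d}\sum_{i=1}^r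 c_i(k_1,k_2)\phi_i(\cdot-k_1,\cdot-k_2)\Big\|_{L^{p,q}}\le\alpha_2\sum_{i=1}^r\|c_i\|_{l^{p,q}};$$ and $|\phi_i(x,y)|\le\tilde c\,(1+|x|)^{-s_1}(1+|y|)^{-s_2}$ for all $i$ and $(x,y)$, with constants $\tilde c>0$ and $s_1,s_2>d+1-\frac1p-\frac dq$. (A2) $\psi\in L^1(\mathbb R\times\mathbb R^d)$ is complex-valued with $\operatorname{supp}\psi\subseteq C_K$. Write $\|\psi\|_1=\|\psi\|_{L^1(\mathbb R\times\mathbb R^d)}=\|\psi\|_{L^{1,1}(C_K)}$. (A3) $\rho$ is a probability density on $C_K$ with $\mathcal C_{\rho,1}\le\rho\le\mathcal C_{\rho,2}$ on $C_K$, where $\mathcal C_{\rho,1},\mathcal C_{\rho,2}>0$ are constants. Let $(z_{j,k})_{j,k\in\mathbb N}$ be independent random points of $C_K$, each with density $\rho$. Put $$c^*=\frac{4\tilde c}{2^{\frac{p+q}{pq}}\alpha_1}\Big(\sum_{k_1\in\mathbb Z}(1+|k_1|)^{-\frac{s_1p}{p-1}}\Big)^{\frac{p-1}p}\Big(\sum_{k_2\in\mathbb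 Z^d}(1+|k_2|)^{-\frac{s_2q}{q-1}}\Big)^{\frac{q-1}q},$$ $$\mathcal A_1=2\exp\big(r(2N+1)^{d+1}\ln(4c^*+1)\big),\qquad \mathcal A_2=\frac{4\big((2c^*+\frac14)(c^*+\frac14)\big)^{r(2N+1)^{d+1}}}{3r(\ln2)^2(2N+1)^{d+1}}.$$ Let $0<\mu\le1$ and $0<\eta<\mu\,\mathcal C_{\rho,1}$, and let $V^{p,q}_{N,\psi}(\Phi,\mu,C_K)$ be the set of all $$f=\sum_{i=1}^r\sum_{|k_1|\le N}\sum_{|k_2|\le N}c_i(k_1,k_2)\phi_i(\cdot-k_1,\cdot-k_2),\qquad c_i(k_1,k_2)\in\mathbb C,$$ with $\mu\|\psi\|_1\|f\|_{L^{p,q}}\le\int_{C_K}|(f*\psi)(x,y)|\,dx\,dy$. Let $n,m\in\mathbb N$ satisfy $$nm>\frac{54r\sqrt2(\ln2)(2N+1)^{d+1}}{\eta}\Big(2+\frac{81}{\eta}\Big).$$ Then, with probability at least $$1-\mathcal A_1\exp\Big(-nm\frac{3\eta^2}{4c^*(6c^*+\eta)}\Big)-\mathcal A_2\exp\Big(-nm\frac{\eta^2}{18\sqrt2(81+2\eta)}\Big),$$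 the following two inequalities hold simultaneously for all $f\in V^{p,q}_{N,\psi}(\Phi,\mu,C_K)$: $$nm\|\psi\|_1(\mu\,\mathcal C_{\rho,1}-\eta)\|f\|_{L^{p,q}}\le\sum_{j=1}^n\sum_{k=1}^m|(f*\psi)(z_{j,k})|\le nm\|\psi\|_1\Big(\mathcal C_{\rho,2}(2K_1)^{\frac{p-1}p}(2K_2)^{\frac{d(q-1)}q}+\eta\Big)\|f\|_{L^{p,q}}.$$ -/

import Mathlib

open MeasureTheory ProbabilityTheory
open scoped ENNReal

noncomputable section

namespace MixedSampling

/-- The space `ℝ × ℝ^d`, with the Euclidean norm on `ℝ^d`. -/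
abbrev Pt (d : ℕ) : Type := ℝ × EuclideanSpace ℝ (Fin d)

/-- Multi-indices `k₂ ∈ ℤ^d`; the norm `‖k₂‖` is the maximum of the `|(k₂)_i|`. -/
abbrev Idx (d : ℕ) : Type := Fin d → ℤ

/-- The cuboid `C_K = [-K₁, K₁] × [-K₂, K₂]^d`. -/
def cuboid (d : ℕ) (K₁ K₂ : ℝ) : Set (Pt d) :=
  {z | |z.1| ≤ K₁ ∧ ∀ i, |z.2 i| ≤ K₂}

/-- The mixed Lebesgue norm `(∫ (∫ |f(x,y)|^q dy)^{p/q} dx)^{1/p}`, with value `∞` when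
`f ∉ L^{p,q}(ℝ × ℝ^d)`. -/
def mixedNorm {d : ℕ} (p q : ℝ) (f : Pt d → ℂ) : ℝ≥0∞ :=
  (∫⁻ x : ℝ, (∫⁻ y : EuclideanSpace ℝ (Fin d), ‖f (x, y)‖ₑ ^ q) ^ (p / q)) ^ (1 / p)

/-- The mixed sequence norm `(∑ (∑ |c(k₁,k₂)|^q)^{p/q})^{1/p}`, with value `∞` when
`c ∉ l^{p,q}(ℤ × ℤ^d)`. -/
def mixedSeqNorm {d : ℕ} (p q : ℝ) (c : ℤ → Idx d → ℂ) : ℝ≥0∞ :=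
  (∑' k₁ : ℤ, (∑' k₂ : Idx d, ‖c k₁ k₂‖ₑ ^ q) ^ (p / q)) ^ (1 / p)

/-- The translate `g(· - k₁, · - k₂)`. -/
def shift {d : ℕ} (g : Pt d → ℂ) (k₁ : ℤ) (k₂ : Idx d) : Pt d → ℂ :=
  fun z => g (z.1 - (k₁ : ℝ), z.2 - WithLp.toLp 2 (fun i => (k₂ i : ℝ)))

/-- The series `∑_{k₁,k₂} c^T(k₁,k₂) Φ(· - k₁, · - k₂)`, summed pointwise. -/
def synthesis {d r : ℕ} (Φ : Fin r → Pt d → ℂ) (c : Fin r → ℤ → Idx d → ℂ) : Pt d → ℂ :=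
  fun z => ∑' k : ℤ × Idx d, ∑ i, c i k.1 k.2 * shift (Φ i) k.1 k.2 z

/-- Stable shifts with constants `α₁, α₂`:
`α₁ ‖c‖ ≤ ‖∑ c^T(k₁,k₂) Φ(· - k₁, · - k₂)‖_{L^{p,q}} ≤ α₂ ‖c‖` for all `c ∈ (l^{p,q})^r`, where
`‖c‖ = ∑ i, ‖c_i‖_{l^{p,q}}`. -/
def StableShifts {d r : ℕ} (p q : ℝ) (Φ : Fin r → Pt d → ℂ) (α₁ α₂ : ℝ) : Prop :=
  ∀ c : Fin r → ℤ → Idx d → ℂ, (∀ i, mixedSeqNorm p q (c i) < ∞) →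
    ENNReal.ofReal α₁ * ∑ i, mixedSeqNorm p q (c i) ≤ mixedNorm p q (synthesis Φ c) ∧
    mixedNorm p q (synthesis Φ c) ≤ ENNReal.ofReal α₂ * ∑ i, mixedSeqNorm p q (c i)

/-- Polynomial decay `|φ_i(x,y)| ≤ C (1+|x|)^{-s₁} (1+|y|)^{-s₂}` of all the generators. -/
def PolynomialDecay {d r : ℕ} (Φ : Fin r → Pt d → ℂ) (C s₁ s₂ : ℝ) : Prop :=
  ∀ i, ∀ z : Pt d, ‖Φ i z‖ ≤ C / ((1 + |z.1|) ^ s₁ * (1 + ‖z.2‖) ^ s₂)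

/-- The finite dimensional space `V_N^{p,q}(Φ)`: the combinations
`∑_i ∑_{|k₁| ≤ N} ∑_{|k₂| ≤ N} c_i(k₁,k₂) φ_i(· - k₁, · - k₂)`. -/
def VN {d r : ℕ} (Φ : Fin r → Pt d → ℂ) (N : ℕ) : Set (Pt d → ℂ) :=
  {f | ∃ c : Fin r → ℤ → Idx d → ℂ, ∀ z, f z =
    ∑ i, ∑ k₁ ∈ Finset.Icc (-(N : ℤ)) N,
      ∑ k₂ ∈ Fintype.piFinset (fun _ : Fin d => Finset.Icc (-(N : ℤ)) N),
        c i k₁ k₂ * shift (Φ i) k₁ k₂ z}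

/-- The convolution `f * ψ` on `ℝ × ℝ^d`. -/
def conv {d : ℕ} (f ψ : Pt d → ℂ) : Pt d → ℂ :=
  convolution f ψ (ContinuousLinearMap.mul ℂ ℂ) volume

/-- The set `V^{p,q}_{N,ψ}(Φ, μ, C_K)` of the `f ∈ V_N^{p,q}(Φ)` with
`μ ‖ψ‖_{L^1} ‖f‖_{L^{p,q}} ≤ ∫_{C_K} |f * ψ|`. -/
def VNpsi {d r : ℕ} (p q : ℝ) (Φ : Fin r → Pt d → ℂ) (N : ℕ) (ψ : Pt d → ℂ)
    (μ K₁ K₂ : ℝ) : Set (Pt d → ℂ) :=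
  {f | f ∈ VN Φ N ∧
    μ * (∫ z, ‖ψ z‖) * (mixedNorm p q f).toReal ≤ ∫ z in cuboid d K₁ K₂, ‖conv f ψ z‖}

/-- The constant `c^*`. -/
def cStar (d : ℕ) (p q C α₁ s₁ s₂ : ℝ) : ℝ :=
  4 * C / ((2 : ℝ) ^ ((p + q) / (p * q)) * α₁) *
    (∑' k₁ : ℤ, 1 / (1 + |(k₁ : ℝ)|) ^ (s₁ * p / (p - 1))) ^ ((p - 1) / p) *
    (∑' k₂ : Idx d, 1 / (1 + ‖k₂‖) ^ (s₂ * q / (q - 1))) ^ ((q - 1) / q)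

/-- The constant `𝒜₁`, as a function of `c = c^*`. -/
def A₁ (d r N : ℕ) (c : ℝ) : ℝ :=
  2 * Real.exp (r * (2 * N + 1) ^ (d + 1) * Real.log (4 * c + 1))

/-- The constant `𝒜₂`, as a function of `c = c^*`. -/
def A₂ (d r N : ℕ) (c : ℝ) : ℝ :=
  4 * ((2 * c + 1 / 4) * (c + 1 / 4)) ^ (r * (2 * N + 1) ^ (d + 1)) /
    (3 * r * (Real.log 2) ^ 2 * (2 * N + 1) ^ (d + 1))

end MixedSampling

end

namespace MixedSampling

/-! The theorem is a uniform law of large numbers for the moduli `|f * ψ|`, with `f` in a complex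
space spanned by `D = r (2N+1)^(d+1)` shifts.

Boundedness. Stability controls the coefficients of `f` by its mixed norm, and Hölder in mixed
sequence norms bounds `|f|` pointwise by the coefficients times lattice sums of `(1 + |y -
k|)^(-s)`. Such a sum is largest at `y = 0`: the power is a mixture of Gaussians, and a periodized
Gaussian has positive Fourier coefficients. This gives `‖f‖_∞ ≤ c* ‖f‖`
(`enorm_le_cStar_mul_mixedNorm`), so after division by `‖ψ‖₁ ‖f‖` every `f * ψ` lies in a class
bounded by `c*` and stable under multiplication by unimodular scalars.

Concentration. The supremum over the class of the centred sum of moduli changes by at most `c*` when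
one sample point changes, so McDiarmid's inequality concentrates it about its mean. For the mean,
averaging over rotations of the complex plane replaces moduli by absolute values of real parts;
symmetrization and contraction remove the absolute value; Cauchy–Schwarz against an orthonormal
basis of the span leaves `π c* √(nm D)`. With `3/4` of the allowed deviation `nm η` reserved for the
mean and `1/4` for the fluctuation, this yields `exists_measurableSet_concentration`, with no
covering numbers.

Constants. The resulting tail `2 exp(-nm η² / (8 c*²))` is below the `𝒜₁` term alone, so the `𝒜₂`
term can be dropped. The condition that the mean be at most `3/4 nm η` follows from the assumed
sample size if `c* ≤ 10`, and otherwise from the `𝒜₁` term being less than `1`, without which there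
is nothing to prove.

Conclusion. The bounds on `ρ` compare the mean under the sampling law with the integral over the
cuboid. The defining inequality of the class bounds that integral from below; Young and Hölder bound
it from above. -/

/-! ### Periodized Gaussians -/

lemma summable_exp_neg_mul_sub_sq {a : ℝ} (ha : 0 < a) (y : ℝ) :
    Summable fun k : ℤ => Real.exp (-(a * (y - k) ^ 2)) := by
  -- Expanding the square, the summand is `exp(-a y²)` times the modulus of a Jacobi theta term with
  -- `τ = i a / π` and `z = -i a y / π`.
  have h := (summable_jacobiTheta₂_term_iff (-(Complex.I * (a * y / Real.pi : ℝ)))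
    (Complex.I * (a / Real.pi : ℝ))).mpr (by simp; positivity)
  have h2 := (h.norm).mul_left (Real.exp (-(a * y ^ 2)))
  refine h2.congr fun k => ?_
  rw [jacobiTheta₂_term, Complex.norm_exp, ← Real.exp_add]
  congr 1
  have : (2 * (Real.pi : ℂ) * Complex.I * (k : ℂ) * -(Complex.I * ((a * y / Real.pi : ℝ) : ℂ)) +
      Real.pi * Complex.I * (k : ℂ) ^ 2 * (Complex.I * ((a / Real.pi : ℝ) : ℂ)))
      = ((2 * a * y * k - a * k ^ 2 : ℝ) : ℂ) := by
    have hpi : (Real.pi : ℂ) ≠ 0 := by exact_mod_cast Real.pi_ne_zero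
    push_cast
    field_simp
    ring_nf
    simp
    ring
  rw [this, Complex.ofReal_re]
  ring

/-- The periodized Gaussian is maximal at the lattice points. -/
lemma tsum_exp_neg_mul_sub_sq_le {a : ℝ} (ha : 0 < a) (y : ℝ) :
    ∑' k : ℤ, Real.exp (-(a * (y - k) ^ 2)) ≤ ∑' k : ℤ, Real.exp (-(a * (k : ℝ) ^ 2)) := by
  have hpi : (Real.pi : ℂ) ≠ 0 := by exact_mod_cast Real.pi_ne_zero
  have ha' : (a : ℂ) ≠ 0 := by exact_mod_cast ha.ne'
  set A : ℝ := Real.pi / a with hA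
  have hA0 : 0 < A := by positivity
  -- Poisson summation with `A = π / a`. In the resulting Fourier series in `y` all coefficients are
  -- positive, so the triangle inequality bounds the sum by its value at `y = 0`.
  have key : ∀ y : ℝ, ((∑' k : ℤ, Real.exp (-(a * (y - k) ^ 2)) : ℝ) : ℂ) =
      (A : ℂ) ^ (1 / 2 : ℂ) *
        ∑' n : ℤ, Complex.exp (-Real.pi * A * n ^ 2 + 2 * Real.pi * (Complex.I * y) * n) := by
    intro y
    rw [Complex.tsum_exp_neg_quadratic (a := A) (by simpa using hA0) (Complex.I * y),
      ← mul_assoc, mul_one_div_cancel, one_mul, Complex.ofReal_tsum]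
    · congr 1
      ext k
      rw [Complex.ofReal_exp]
      congr 1
      rw [hA]
      push_cast
      have : (k : ℂ) + Complex.I * (Complex.I * y) = k - y := by
        rw [← mul_assoc, Complex.I_mul_I]; ring
      rw [this]
      field_simp
      ring
    · rw [Ne, Complex.cpow_eq_zero_iff]
      simp [hA0.ne']
  have hsum : Summable fun n : ℤ => Real.exp (-(Real.pi * A * n ^ 2)) := by
    have := summable_exp_neg_mul_sub_sq (a := Real.pi * A) (by positivity) 0
    simpa using this
  have hterm : ∀ (y : ℝ) (n : ℤ), ‖Complex.exp (-Real.pi * A * n ^ 2 +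
      2 * Real.pi * (Complex.I * y) * n)‖ = Real.exp (-(Real.pi * A * n ^ 2)) := by
    intro y n
    rw [Complex.norm_exp]
    congr 1
    have : (-Real.pi * A * n ^ 2 + 2 * Real.pi * (Complex.I * y) * n : ℂ) =
      ((-(Real.pi * A * n ^ 2) : ℝ) : ℂ) + ((2 * Real.pi * y * n : ℝ) : ℂ) * Complex.I := by
      push_cast; ring
    rw [this, Complex.add_re, Complex.ofReal_re, Complex.re_ofReal_mul, Complex.I_re, mul_zero,
      add_zero]
  have h0 := key 0
  have hz : (∑' n : ℤ, Complex.exp (-Real.pi * A * n ^ 2 + 2 * Real.pi * (Complex.I * (0:ℝ)) * n))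
      = ((∑' n : ℤ, Real.exp (-(Real.pi * A * n ^ 2)) : ℝ) : ℂ) := by
    rw [Complex.ofReal_tsum]
    congr 1
    ext n
    rw [Complex.ofReal_exp]
    congr 1
    push_cast
    ring
  rw [hz] at h0
  have hnonneg : ∀ y : ℝ, 0 ≤ ∑' k : ℤ, Real.exp (-(a * (y - k) ^ 2)) := fun y =>
    tsum_nonneg fun k => (Real.exp_pos _).le
  have h0' : ∑' k : ℤ, Real.exp (-(a * ((0:ℝ) - k) ^ 2)) =
      ‖(A : ℂ) ^ (1 / 2 : ℂ)‖ * ∑' n : ℤ, Real.exp (-(Real.pi * A * n ^ 2)) := by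
    have := congrArg norm h0
    rw [norm_mul, Complex.norm_real, Complex.norm_real, Real.norm_of_nonneg (hnonneg 0),
      Real.norm_of_nonneg (tsum_nonneg fun k => (Real.exp_pos _).le)] at this
    exact this
  have hy := congrArg norm (key y)
  rw [norm_mul, Complex.norm_real, Real.norm_of_nonneg (hnonneg y)] at hy
  have hfin : ∑' k : ℤ, Real.exp (-(a * (k : ℝ) ^ 2)) =
      ∑' k : ℤ, Real.exp (-(a * ((0:ℝ) - k) ^ 2)) := by simp
  rw [hfin, h0', hy]
  gcongr
  refine (norm_tsum_le_tsum_norm ?_).trans_eq ?_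
  · simpa only [hterm] using hsum
  · simp only [hterm]

lemma ennreal_tsum_exp_neg_mul_sub_sq_le {a : ℝ} (ha : 0 < a) (y : ℝ) :
    ∑' k : ℤ, ENNReal.ofReal (Real.exp (-(a * (y - k) ^ 2))) ≤
      ∑' k : ℤ, ENNReal.ofReal (Real.exp (-(a * (k : ℝ) ^ 2))) := by
  have h0 : Summable fun k : ℤ => Real.exp (-(a * (k : ℝ) ^ 2)) := by
    simpa using summable_exp_neg_mul_sub_sq ha 0
  rw [← ENNReal.ofReal_tsum_of_nonneg (fun _ => (Real.exp_pos _).le)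
    (summable_exp_neg_mul_sub_sq ha y),
    ← ENNReal.ofReal_tsum_of_nonneg (fun _ => (Real.exp_pos _).le) h0]
  exact ENNReal.ofReal_le_ofReal (tsum_exp_neg_mul_sub_sq_le ha y)

/-- Distributivity, free of summability conditions in `ℝ≥0∞`; it reduces sums over `ℤ^d` to the
one-dimensional case, both for Gaussians and for products of powers. -/
lemma ennreal_tsum_pi_prod {d : ℕ} (F : Fin d → ℤ → ℝ≥0∞) :
    ∑' k : Fin d → ℤ, ∏ i, F i (k i) = ∏ i, ∑' n, F i n := by
  induction d with
  | zero => simp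
  | succ d ih =>
    rw [← (Fin.consEquiv fun _ => ℤ).tsum_eq, ENNReal.tsum_prod']
    simp only [Fin.consEquiv_apply, Fin.prod_univ_succ, Fin.cons_zero, Fin.cons_succ]
    simp_rw [ENNReal.tsum_mul_left, ih (fun i => F i.succ), ENNReal.tsum_mul_right]

/-- Periodized Gaussians on `ℝ^d` are maximal at the lattice points. -/
lemma tsum_gaussian_shift_le {d : ℕ} {a : ℝ} (ha : 0 < a) (y : EuclideanSpace ℝ (Fin d)) :
    ∑' k : Idx d, ENNReal.ofReal
        (Real.exp (-(a * ‖y - WithLp.toLp 2 (fun i => (k i : ℝ))‖ ^ 2))) ≤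
      ∑' k : Idx d, ENNReal.ofReal
        (Real.exp (-(a * ‖(WithLp.toLp 2 (fun i => (k i : ℝ)) : EuclideanSpace ℝ (Fin d))‖ ^ 2))) := by
  have e : ∀ v : EuclideanSpace ℝ (Fin d), ENNReal.ofReal (Real.exp (-(a * ‖v‖ ^ 2))) =
      ∏ i, ENNReal.ofReal (Real.exp (-(a * (v i) ^ 2))) := by
    intro v
    rw [EuclideanSpace.norm_sq_eq, ← ENNReal.ofReal_prod_of_nonneg
      (fun _ _ => (Real.exp_pos _).le), ← Real.exp_sum]
    simp [Finset.mul_sum]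
  simp_rw [e]
  have h1 := ennreal_tsum_pi_prod (d := d)
    (fun i n => ENNReal.ofReal (Real.exp (-(a * (y i - n) ^ 2))))
  have h2 := ennreal_tsum_pi_prod (d := d)
    (fun _ n => ENNReal.ofReal (Real.exp (-(a * (n : ℝ) ^ 2))))
  simp only [PiLp.sub_apply]
  rw [h1, h2]
  exact Finset.prod_le_prod' fun i _ => ennreal_tsum_exp_neg_mul_sub_sq_le ha (y i)

/-! ### Powers as mixtures of Gaussians, and maximality of lattice sums at the origin -/

/-- The preimage of `w` is the positive root of `x² - w x - c = 0`. With injectivity below, this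
makes `x - c / x` a change of variables from the half-line to the line. -/
lemma image_sub_div_Ioi {c : ℝ} (hc : 0 < c) :
    (fun x : ℝ => x - c / x) '' Set.Ioi 0 = Set.univ := by
  refine Set.eq_univ_of_forall fun w => ?_
  have hs : |w| < √(w ^ 2 + 4 * c) := by
    rw [← Real.sqrt_sq_eq_abs]
    exact Real.sqrt_lt_sqrt (sq_nonneg _) (by linarith)
  have hsq : √(w ^ 2 + 4 * c) ^ 2 = w ^ 2 + 4 * c := Real.sq_sqrt (by positivity)
  have hx : 0 < (w + √(w ^ 2 + 4 * c)) / 2 := by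
    have := neg_abs_le w
    linarith
  refine ⟨(w + √(w ^ 2 + 4 * c)) / 2, hx, ?_⟩
  have hne : w + √(w ^ 2 + 4 * c) ≠ 0 := by linarith
  simp only
  field_simp
  linear_combination hsq

lemma injOn_sub_div_Ioi {c : ℝ} (hc : 0 < c) :
    Set.InjOn (fun x : ℝ => x - c / x) (Set.Ioi 0) := by
  have : StrictMonoOn (fun x : ℝ => x - c / x) (Set.Ioi 0) := by
    intro x hx y hy hxy
    have h1 : c / y < c / x := div_lt_div_of_pos_left hc hx hxy
    simp only
    linarith
  exact this.injOn

/-- The Cauchy–Schlömilch transformation of the Gaussian integral. -/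
lemma lintegral_exp_neg_sq_add_div_sq {c : ℝ} (hc : 0 ≤ c) :
    ∫⁻ x in Set.Ioi (0 : ℝ), ENNReal.ofReal (Real.exp (-(x ^ 2 + c ^ 2 / x ^ 2))) =
      ENNReal.ofReal (√Real.pi / 2) * ENNReal.ofReal (Real.exp (-(2 * c))) := by
  have gauss : ∫⁻ x : ℝ, ENNReal.ofReal (Real.exp (-x ^ 2)) = ENNReal.ofReal √Real.pi := by
    rw [← ofReal_integral_eq_lintegral_ofReal]
    · have := integral_gaussian 1
      simp only [one_mul, neg_mul, div_one] at this
      rw [this]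
    · simpa using integrable_exp_neg_mul_sq (b := 1) one_pos
    · exact Filter.Eventually.of_forall fun _ => (Real.exp_pos _).le
  have gauss_half : ∫⁻ x in Set.Ioi (0:ℝ), ENNReal.ofReal (Real.exp (-x ^ 2)) =
      ENNReal.ofReal (√Real.pi / 2) := by
    rw [← ofReal_integral_eq_lintegral_ofReal]
    · have := integral_gaussian_Ioi 1
      simp only [one_mul, neg_mul, div_one] at this
      rw [this]
    · have h := (integrable_exp_neg_mul_sq (b := 1) one_pos).integrableOn (s := Set.Ioi 0)
      simp only [neg_mul, one_mul] at h
      exact h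
    · exact Filter.Eventually.of_forall fun _ => (Real.exp_pos _).le
  rcases hc.eq_or_lt with rfl | hc
  · simpa using gauss_half
  set G : ℝ → ℝ≥0∞ := fun x => ENNReal.ofReal (Real.exp (-(x ^ 2 + c ^ 2 / x ^ 2))) with hG
  have hGm : Measurable G := by fun_prop
  have hd : ∀ x ∈ Set.Ioi (0:ℝ), HasDerivWithinAt (fun x : ℝ => c / x) (-(c / x ^ 2))
      (Set.Ioi 0) x := by
    intro x hx
    have hx' : x ≠ 0 := ne_of_gt hx
    have := ((hasDerivAt_inv hx').const_mul c).hasDerivWithinAt (s := Set.Ioi (0:ℝ))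
    refine (this.congr_deriv ?_)
    field_simp
  have himg : (fun x : ℝ => c / x) '' Set.Ioi 0 = Set.Ioi 0 := by
    ext w
    constructor
    · rintro ⟨x, hx, rfl⟩
      exact div_pos hc hx
    · intro hw
      exact ⟨c / w, div_pos hc hw, by field_simp⟩
  have hinj : Set.InjOn (fun x : ℝ => c / x) (Set.Ioi 0) := by
    intro x hx y hy h
    have hx' : x ≠ 0 := ne_of_gt hx
    have hy' : y ≠ 0 := ne_of_gt hy
    simp only at h
    field_simp at h
    exact h.symm
  -- The substitution `x ↦ c / x` exchanges the two summands of the exponent `x² + c² / x²`.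
  have swap : ∫⁻ x in Set.Ioi (0:ℝ), G x =
      ∫⁻ x in Set.Ioi (0:ℝ), ENNReal.ofReal (c / x ^ 2) * G x := by
    have := lintegral_image_eq_lintegral_abs_deriv_mul measurableSet_Ioi hd hinj G
    rw [himg] at this
    rw [this]
    refine setLIntegral_congr_fun measurableSet_Ioi fun x hx => ?_
    have hx' : x ≠ 0 := ne_of_gt hx
    have hx0 : (0:ℝ) < x := hx
    simp only [hG]
    rw [abs_neg, abs_of_nonneg (by positivity)]
    congr 4
    field_simp
    ring
  have hd2 : ∀ x ∈ Set.Ioi (0:ℝ), HasDerivWithinAt (fun x : ℝ => x - c / x) (1 + c / x ^ 2)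
      (Set.Ioi 0) x := by
    intro x hx
    refine (((hasDerivAt_id x).hasDerivWithinAt).sub (hd x hx)).congr_deriv ?_
    ring
  have main := lintegral_image_eq_lintegral_abs_deriv_mul measurableSet_Ioi hd2
    (injOn_sub_div_Ioi hc) (fun w => ENNReal.ofReal (Real.exp (-w ^ 2)))
  rw [image_sub_div_Ioi hc, setLIntegral_univ, gauss] at main
  -- Since `(x - c/x)² = x² + c²/x² - 2c` and the Jacobian is `1 + c/x²`, the full Gaussian integral
  -- is `exp(2c)` times the sum of the two equal integrals related by `swap`.
  have main2 : ENNReal.ofReal √Real.pi =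
      ENNReal.ofReal (Real.exp (2 * c)) * (2 * ∫⁻ x in Set.Ioi (0:ℝ), G x) := by
    rw [main, two_mul (∫⁻ x in Set.Ioi (0:ℝ), G x)]
    nth_rewrite 2 [swap]
    rw [← lintegral_add_left hGm, ← lintegral_const_mul _ (by fun_prop)]
    refine setLIntegral_congr_fun measurableSet_Ioi fun x hx => ?_
    have hx' : x ≠ 0 := ne_of_gt hx
    have hx0 : (0:ℝ) < x := hx
    simp only [hG]
    rw [abs_of_nonneg (by positivity), ENNReal.ofReal_add (by positivity) (by positivity),
      ENNReal.ofReal_one, ← one_add_mul, ← mul_assoc, mul_comm (ENNReal.ofReal (Real.exp (2 * c))),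
      mul_assoc, ← ENNReal.ofReal_mul (Real.exp_pos _).le, ← Real.exp_add]
    congr 4
    field_simp
    ring
  have h3 : ENNReal.ofReal (√Real.pi / 2) * ENNReal.ofReal (Real.exp (-(2 * c))) =
      ENNReal.ofReal (1 / 2 * Real.exp (-(2 * c))) * ENNReal.ofReal √Real.pi := by
    rw [← ENNReal.ofReal_mul (by positivity), ← ENNReal.ofReal_mul (by positivity)]
    congr 1; ring
  rw [h3, main2, ← mul_assoc, ← mul_assoc, ← ENNReal.ofReal_mul (by positivity), mul_assoc (1 / 2),
    ← Real.exp_add]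
  simp only [neg_add_cancel, Real.exp_zero, mul_one]
  rw [show (2 : ℝ≥0∞) = ENNReal.ofReal 2 by simp, ← ENNReal.ofReal_mul (by positivity)]
  norm_num

/-- `(1 + r)^{-s}` as a mixture of the Gaussians `exp (-a r ^ 2)`. -/
lemma one_add_rpow_neg_eq_lintegral {s : ℝ} (hs : 0 < s) {r : ℝ} (hr : 0 ≤ r) :
    ENNReal.ofReal ((1 + r) ^ (-s)) =
      ENNReal.ofReal (1 / Real.Gamma s) * ∫⁻ t in Set.Ioi (0 : ℝ),
        ENNReal.ofReal (t ^ (s - 1) * Real.exp (-t)) *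
          (ENNReal.ofReal (2 / √Real.pi) * ∫⁻ x in Set.Ioi (0 : ℝ),
            ENNReal.ofReal (Real.exp (-x ^ 2)) *
              ENNReal.ofReal (Real.exp (-(t ^ 2 / (4 * x ^ 2) * r ^ 2)))) := by
  have hG := Real.Gamma_pos_of_pos hs
  -- Subordination: Cauchy–Schlömilch with `c = t r / 2` makes the Gaussian mixture equal to `exp(-t
  -- r)`. What is left is the Gamma integral for `(1 + r)^(-s)`.
  have inner : ∀ t ∈ Set.Ioi (0:ℝ), (ENNReal.ofReal (2 / √Real.pi) * ∫⁻ x in Set.Ioi (0 : ℝ),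
            ENNReal.ofReal (Real.exp (-x ^ 2)) *
              ENNReal.ofReal (Real.exp (-(t ^ 2 / (4 * x ^ 2) * r ^ 2)))) =
      ENNReal.ofReal (Real.exp (-(t * r))) := by
    intro t ht
    have ht0 : (0:ℝ) < t := ht
    have := lintegral_exp_neg_sq_add_div_sq (c := t * r / 2) (by positivity)
    have e : ∫⁻ x in Set.Ioi (0 : ℝ), ENNReal.ofReal (Real.exp (-x ^ 2)) *
              ENNReal.ofReal (Real.exp (-(t ^ 2 / (4 * x ^ 2) * r ^ 2))) =
        ∫⁻ x in Set.Ioi (0 : ℝ), ENNReal.ofReal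
          (Real.exp (-(x ^ 2 + (t * r / 2) ^ 2 / x ^ 2))) := by
      refine setLIntegral_congr_fun measurableSet_Ioi fun x hx => ?_
      have hx' : x ≠ 0 := ne_of_gt hx
      rw [← ENNReal.ofReal_mul (Real.exp_pos _).le, ← Real.exp_add]
      congr 2
      field_simp
      ring
    have hpi := Real.pi_pos
    rw [e, this, ← mul_assoc, ← ENNReal.ofReal_mul (by positivity)]
    rw [show 2 / √Real.pi * (√Real.pi / 2) = 1 by field_simp, ENNReal.ofReal_one, one_mul]
    congr 2
    ring
  have e2 : ∫⁻ t in Set.Ioi (0 : ℝ),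
        ENNReal.ofReal (t ^ (s - 1) * Real.exp (-t)) *
          (ENNReal.ofReal (2 / √Real.pi) * ∫⁻ x in Set.Ioi (0 : ℝ),
            ENNReal.ofReal (Real.exp (-x ^ 2)) *
              ENNReal.ofReal (Real.exp (-(t ^ 2 / (4 * x ^ 2) * r ^ 2)))) =
      ∫⁻ t in Set.Ioi (0 : ℝ), ENNReal.ofReal (t ^ (s - 1) * Real.exp (-((1 + r) * t))) := by
    refine setLIntegral_congr_fun measurableSet_Ioi fun t ht => ?_
    have ht0 : (0:ℝ) < t := ht
    rw [inner t ht, ← ENNReal.ofReal_mul (by positivity), mul_assoc, ← Real.exp_add]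
    congr 3
    ring
  have hr1 : 0 < 1 + r := by linarith
  rw [e2, ← ofReal_integral_eq_lintegral_ofReal, Real.integral_rpow_mul_exp_neg_mul_Ioi hs hr1,
    ← ENNReal.ofReal_mul (by positivity)]
  · congr 1
    rw [one_div (1 + r), Real.inv_rpow hr1.le, Real.rpow_neg hr1.le]
    field_simp
  · have := Real.integral_rpow_mul_exp_neg_mul_Ioi hs hr1
    by_contra h
    rw [integral_undef h] at this
    have : 0 < (1 / (1 + r)) ^ s * Real.Gamma s := by positivity
    linarith
  · refine (ae_restrict_iff' measurableSet_Ioi).mpr (Filter.Eventually.of_forall fun t ht => ?_)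
    have ht0 : (0:ℝ) < t := ht
    simp only [Pi.zero_apply]
    positivity

/-- Lattice sums of `(1 + |y - k|)^{-s}` are maximal at `y = 0`. -/
lemma tsum_one_add_norm_sub_rpow_le {d : ℕ} {s : ℝ} (hs : 0 < s) (y : EuclideanSpace ℝ (Fin d)) :
    ∑' k : Idx d, ENNReal.ofReal
        ((1 + ‖y - WithLp.toLp 2 (fun i => (k i : ℝ))‖) ^ (-s)) ≤
      ∑' k : Idx d, ENNReal.ofReal
        ((1 + ‖(WithLp.toLp 2 (fun i => (k i : ℝ)) : EuclideanSpace ℝ (Fin d))‖) ^ (-s)) := by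
  -- By Tonelli the lattice sum passes inside both integrals. The weights are nonnegative and do not
  -- depend on `v`, so the Gaussian comparison can be applied pointwise under them.
  have rep : ∀ v : Idx d → ℝ, (∀ k, 0 ≤ v k) →
      ∑' k, ENNReal.ofReal ((1 + v k) ^ (-s)) =
      ENNReal.ofReal (1 / Real.Gamma s) * ∫⁻ t in Set.Ioi (0 : ℝ),
        ENNReal.ofReal (t ^ (s - 1) * Real.exp (-t)) *
          (ENNReal.ofReal (2 / √Real.pi) * ∫⁻ x in Set.Ioi (0 : ℝ),
            ENNReal.ofReal (Real.exp (-x ^ 2)) * ∑' k,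
              ENNReal.ofReal (Real.exp (-(t ^ 2 / (4 * x ^ 2) * v k ^ 2)))) := by
    intro v hv
    simp_rw [fun k => one_add_rpow_neg_eq_lintegral hs (hv k)]
    have m1 : ∀ k, Measurable fun t : ℝ => ∫⁻ x in Set.Ioi (0 : ℝ),
        ENNReal.ofReal (Real.exp (-x ^ 2)) *
          ENNReal.ofReal (Real.exp (-(t ^ 2 / (4 * x ^ 2) * v k ^ 2))) := by
      intro k
      refine Measurable.lintegral_prod_right' (f := fun z : ℝ × ℝ =>
        ENNReal.ofReal (Real.exp (-z.2 ^ 2)) *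
          ENNReal.ofReal (Real.exp (-(z.1 ^ 2 / (4 * z.2 ^ 2) * v k ^ 2)))) ?_
      fun_prop
    rw [ENNReal.tsum_mul_left, ← lintegral_tsum]
    · congr 1
      refine lintegral_congr fun t => ?_
      rw [ENNReal.tsum_mul_left, ENNReal.tsum_mul_left, ← lintegral_tsum]
      · simp_rw [ENNReal.tsum_mul_left]
      · intro k
        fun_prop
    · intro k
      have := m1 k
      fun_prop
  rw [rep _ fun _ => norm_nonneg _, rep _ fun _ => norm_nonneg _]
  refine mul_le_mul_right ?_ _
  refine setLIntegral_mono' measurableSet_Ioi fun t ht => ?_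
  have ht0 : (0:ℝ) < t := ht
  refine mul_le_mul_right (mul_le_mul_right ?_ _) _
  refine setLIntegral_mono' measurableSet_Ioi fun x hx => ?_
  have hx0 : (0:ℝ) < x := hx
  exact mul_le_mul_right (tsum_gaussian_shift_le (by positivity) y) _

/-! ### Convergence of the lattice sums in `cStar` -/

lemma summable_one_div_one_add_abs_rpow {s : ℝ} (hs : 1 < s) :
    Summable fun k : ℤ => 1 / (1 + |(k : ℝ)|) ^ s := by
  refine (Real.summable_abs_int_rpow hs).of_norm_bounded_eventually ?_
  have : ({0} : Set ℤ)ᶜ ∈ Filter.cofinite := (Set.finite_singleton 0).compl_mem_cofinite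
  filter_upwards [this] with k hk
  have hk' : (k : ℝ) ≠ 0 := by exact_mod_cast hk
  have hpos : 0 < |(k : ℝ)| := abs_pos.mpr hk'
  rw [Real.norm_of_nonneg (by positivity), Real.rpow_neg (abs_nonneg _), one_div]
  gcongr
  linarith

/-- As `‖k‖` dominates every `|k i|`, the term is at most the product of the `(1 + |k i|)^(-s/d)`,
and `s / d > 1` makes each factor summable. -/
lemma summable_one_div_one_add_norm_rpow {d : ℕ} (hd : 0 < d) {s : ℝ} (hs : (d : ℝ) < s) :
    Summable fun k : Idx d => 1 / (1 + ‖k‖) ^ s := by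
  have hd' : (0 : ℝ) < d := by exact_mod_cast hd
  have h1 : 1 < s / d := by rwa [one_lt_div hd']
  have hle : ∀ k : Idx d, ENNReal.ofReal (1 / (1 + ‖k‖) ^ s) ≤
      ∏ i, ENNReal.ofReal (1 / (1 + |((k i : ℤ) : ℝ)|) ^ (s / d)) := by
    intro k
    rw [← ENNReal.ofReal_prod_of_nonneg (fun _ _ => by positivity)]
    apply ENNReal.ofReal_le_ofReal
    rw [Finset.prod_div_distrib, Finset.prod_const_one]
    apply one_div_le_one_div_of_le (by positivity)
    calc ∏ i, (1 + |((k i : ℤ) : ℝ)|) ^ (s / d) ≤ ∏ _i : Fin d, (1 + ‖k‖) ^ (s / d) := by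
          refine Finset.prod_le_prod (fun _ _ => by positivity) fun i _ => ?_
          have : |((k i : ℤ) : ℝ)| ≤ ‖k‖ := by
            rw [← Int.norm_eq_abs]; exact norm_le_pi_norm k i
          gcongr
      _ = (1 + ‖k‖) ^ s := by
          rw [Finset.prod_const, Finset.card_univ, Fintype.card_fin, ← Real.rpow_natCast,
            ← Real.rpow_mul (by positivity), div_mul_cancel₀ _ hd'.ne']
  have hfin : ∑' k : Idx d, ENNReal.ofReal (1 / (1 + ‖k‖) ^ s) ≠ ∞ := by
    refine ne_top_of_le_ne_top ?_ (ENNReal.tsum_le_tsum hle)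
    rw [ennreal_tsum_pi_prod (fun _ n => ENNReal.ofReal (1 / (1 + |((n : ℤ) : ℝ)|) ^ (s / d)))]
    refine ENNReal.prod_ne_top fun i _ => ?_
    rw [← ENNReal.ofReal_tsum_of_nonneg (fun _ => by positivity)
      (summable_one_div_one_add_abs_rpow h1)]
    exact ENNReal.ofReal_ne_top
  have := ENNReal.summable_toReal hfin
  refine this.congr fun k => ?_
  rw [ENNReal.toReal_ofReal (by positivity)]

/-- The decay of the generators is in the Euclidean norm, the sum in `cStar` in the maximum norm.
The latter is smaller, so changing norms at `y = 0` only increases the terms. -/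
lemma tsum_one_add_norm_sub_rpow_le_sup {d : ℕ} (hd : 0 < d) {s : ℝ} (hs : (d : ℝ) < s)
    (y : EuclideanSpace ℝ (Fin d)) :
    ∑' k : Idx d, ENNReal.ofReal
        ((1 + ‖y - WithLp.toLp 2 (fun i => (k i : ℝ))‖) ^ (-s)) ≤
      ENNReal.ofReal (∑' k : Idx d, 1 / (1 + ‖k‖) ^ s) := by
  have hs0 : 0 < s := lt_of_le_of_lt (Nat.cast_nonneg d) hs
  rw [ENNReal.ofReal_tsum_of_nonneg (fun _ => by positivity)
    (summable_one_div_one_add_norm_rpow hd hs)]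
  refine (tsum_one_add_norm_sub_rpow_le hs0 y).trans (ENNReal.tsum_le_tsum fun k => ?_)
  apply ENNReal.ofReal_le_ofReal
  rw [Real.rpow_neg (by positivity), ← one_div]
  have : ‖k‖ ≤ ‖(WithLp.toLp 2 (fun i => (k i : ℝ)) : EuclideanSpace ℝ (Fin d))‖ := by
    refine (pi_norm_le_iff_of_nonneg (norm_nonneg _)).mpr fun i => ?_
    have := PiLp.norm_apply_le (WithLp.toLp 2 (fun i => (k i : ℝ)) : EuclideanSpace ℝ (Fin d)) i
    simpa [Int.norm_eq_abs] using this
  gcongr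

lemma tsum_one_add_abs_sub_rpow_le {s : ℝ} (hs : 1 < s) (x : ℝ) :
    ∑' k : ℤ, ENNReal.ofReal ((1 + |x - k|) ^ (-s)) ≤
      ENNReal.ofReal (∑' k : ℤ, 1 / (1 + |(k : ℝ)|) ^ s) := by
  have h := tsum_one_add_norm_sub_rpow_le_sup (d := 1) one_pos (s := s) (by simpa using hs)
    (WithLp.toLp 2 fun _ => x)
  rw [← (Equiv.funUnique (Fin 1) ℤ).symm.tsum_eq,
    ← (Equiv.funUnique (Fin 1) ℤ).symm.tsum_eq] at h
  convert h using 4 with k k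
  · rw [EuclideanSpace.norm_eq]
    simp [Real.sqrt_sq_eq_abs]
  · have : (Equiv.funUnique (Fin 1) ℤ).symm k = fun _ => k := by
      ext
      simp
    rw [← Int.norm_eq_abs, this, pi_norm_const]

/-! ### The supremum norm on `VN` -/

/-- Hölder's inequality for finite mixed sums. -/
lemma sum_sum_mul_le {ι κ : Type*} (S : Finset ι) (T : Finset κ) {p q : ℝ} (hp : 1 < p)
    (hq : 1 < q) (c : ι → κ → ℝ≥0∞) (a : ι → ℝ≥0∞) (b : κ → ℝ≥0∞) :
    ∑ i ∈ S, ∑ j ∈ T, c i j * (a i * b j) ≤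
      (∑ i ∈ S, (∑ j ∈ T, c i j ^ q) ^ (p / q)) ^ (1 / p) *
        ((∑ i ∈ S, a i ^ (p / (p - 1))) ^ ((p - 1) / p) *
          (∑ j ∈ T, b j ^ (q / (q - 1))) ^ ((q - 1) / q)) := by
  have hp' : p.HolderConjugate (p / (p - 1)) := Real.HolderConjugate.conjExponent hp
  have hq' : q.HolderConjugate (q / (q - 1)) := Real.HolderConjugate.conjExponent hq
  set B := (∑ j ∈ T, b j ^ (q / (q - 1))) ^ ((q - 1) / q) with hB
  have h1 : ∀ i ∈ S, ∑ j ∈ T, c i j * (a i * b j) ≤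
      B * ((∑ j ∈ T, c i j ^ q) ^ (1 / q) * a i) := by
    intro i _
    have := ENNReal.inner_le_Lp_mul_Lq T (c i) b hq'
    rw [one_div_div, ← hB] at this
    calc ∑ j ∈ T, c i j * (a i * b j) = a i * ∑ j ∈ T, c i j * b j := by
          rw [Finset.mul_sum]; exact Finset.sum_congr rfl fun j _ => by ring
      _ ≤ a i * ((∑ j ∈ T, c i j ^ q) ^ (1 / q) * B) := by gcongr
      _ = _ := by ring
  refine (Finset.sum_le_sum h1).trans ?_
  rw [← Finset.mul_sum]
  have h2 := ENNReal.inner_le_Lp_mul_Lq S (fun i => (∑ j ∈ T, c i j ^ q) ^ (1 / q)) a hp'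
  simp_rw [one_div_div, ← ENNReal.rpow_mul, one_div_mul_eq_div] at h2
  calc _ ≤ B * _ := mul_le_mul_right h2 B
    _ = _ := by ring

/-- Coefficients outside the window do not enter the finite sum. Setting them to zero makes the
sequences finitely supported, so that `StableShifts` applies to them. -/
lemma VN_exists_synthesis {d r N : ℕ} {p q : ℝ} (hp : 1 < p) (hq : 1 < q)
    {Φ : Fin r → Pt d → ℂ} {f : Pt d → ℂ} (hf : f ∈ VN Φ N) :
    ∃ c : Fin r → ℤ → Idx d → ℂ, (∀ i, mixedSeqNorm p q (c i) < ∞) ∧ f = synthesis Φ c ∧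
      ∀ z, f z = ∑ i, ∑ k₁ ∈ Finset.Icc (-(N : ℤ)) N,
        ∑ k₂ ∈ Fintype.piFinset (fun _ : Fin d => Finset.Icc (-(N : ℤ)) N),
          c i k₁ k₂ * shift (Φ i) k₁ k₂ z := by
  obtain ⟨c, hc⟩ := hf
  set S := Finset.Icc (-(N : ℤ)) N with hS
  set T := Fintype.piFinset (fun _ : Fin d => Finset.Icc (-(N : ℤ)) N) with hT
  set c' : Fin r → ℤ → Idx d → ℂ := fun i k₁ k₂ => if k₁ ∈ S ∧ k₂ ∈ T then c i k₁ k₂ else 0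
    with hc'
  have hz : ∀ z, f z = ∑ i, ∑ k₁ ∈ S, ∑ k₂ ∈ T, c' i k₁ k₂ * shift (Φ i) k₁ k₂ z := by
    intro z
    rw [hc z]
    refine Finset.sum_congr rfl fun i _ => Finset.sum_congr rfl fun k₁ h₁ =>
      Finset.sum_congr rfl fun k₂ h₂ => ?_
    simp only [hc', if_pos (And.intro h₁ h₂)]
  have hq0 : 0 < q := by linarith
  have hp0 : 0 < p := by linarith
  refine ⟨c', fun i => ?_, ?_, hz⟩
  · unfold mixedSeqNorm
    refine ENNReal.rpow_lt_top_of_nonneg (by positivity) (ne_of_lt ?_)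
    have hin : ∀ k₁, ∑' k₂, ‖c' i k₁ k₂‖ₑ ^ q = ∑ k₂ ∈ T, ‖c' i k₁ k₂‖ₑ ^ q := by
      intro k₁
      refine tsum_eq_sum fun k₂ h => ?_
      simp [hc', h, hq0]
    simp_rw [hin]
    rw [tsum_eq_sum (s := S)]
    · refine ENNReal.sum_lt_top.mpr fun k₁ _ => ENNReal.rpow_lt_top_of_nonneg (by positivity)
        (ne_of_lt (ENNReal.sum_lt_top.mpr fun k₂ _ => ?_))
      exact ENNReal.rpow_lt_top_of_nonneg hq0.le (by simp)
    · intro k₁ h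
      have : ∀ k₂, ‖c' i k₁ k₂‖ₑ ^ q = 0 := fun k₂ => by simp [hc', h, hq0]
      simp [this, div_pos hp0 hq0]
  · funext z
    rw [hz z, synthesis, tsum_eq_sum (s := S ×ˢ T)]
    · rw [Finset.sum_product, Finset.sum_comm]
      exact Finset.sum_congr rfl fun k₁ _ => Finset.sum_comm
    · intro k hk
      refine Finset.sum_eq_zero fun i _ => ?_
      rw [Finset.mem_product] at hk
      simp [hc', hk]

lemma cStar_pos (d : ℕ) (hd : 0 < d) {p q C α₁ s₁ s₂ : ℝ}
    (hα₁ : 0 < α₁) (hC : 0 < C) (h₁ : 1 < s₁ * p / (p - 1)) (h₂ : d < s₂ * q / (q - 1)) :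
    0 < cStar d p q C α₁ s₁ s₂ := by
  have hA : 0 < ∑' k₁ : ℤ, 1 / (1 + |(k₁ : ℝ)|) ^ (s₁ * p / (p - 1)) :=
    (summable_one_div_one_add_abs_rpow h₁).tsum_pos (fun _ => by positivity) 0 (by positivity)
  have hB : 0 < ∑' k₂ : Idx d, 1 / (1 + ‖k₂‖) ^ (s₂ * q / (q - 1)) :=
    (summable_one_div_one_add_norm_rpow hd h₂).tsum_pos (fun _ => by positivity) 0 (by positivity)
  unfold cStar
  positivity

/-- On `V_N` the supremum norm is at most `c^*` times the mixed norm. -/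
lemma enorm_le_cStar_mul_mixedNorm {d r N : ℕ} (hd : 0 < d) {p q : ℝ} (hp : 1 < p) (hq : 1 < q)
    {Φ : Fin r → Pt d → ℂ} {α₁ α₂ C s₁ s₂ : ℝ} (hα₁ : 0 < α₁) (hC : 0 < C)
    (h₁ : 1 < s₁ * p / (p - 1)) (h₂ : d < s₂ * q / (q - 1))
    (hstable : StableShifts p q Φ α₁ α₂) (hdecay : PolynomialDecay Φ C s₁ s₂)
    {f : Pt d → ℂ} (hf : f ∈ VN Φ N) (z : Pt d) :
    ‖f z‖ₑ ≤ ENNReal.ofReal (cStar d p q C α₁ s₁ s₂) * mixedNorm p q f := by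
  obtain ⟨c, hcfin, hsyn, hz⟩ := VN_exists_synthesis hp hq hf
  have hlow := (hstable c hcfin).1
  rw [← hsyn] at hlow
  have hp1 : 0 < p - 1 := by linarith
  have hq1 : 0 < q - 1 := by linarith
  have hp0 : 0 < p := by linarith
  have hq0 : 0 < q := by linarith
  set S := Finset.Icc (-(N : ℤ)) N with hS
  set T := Fintype.piFinset (fun _ : Fin d => Finset.Icc (-(N : ℤ)) N) with hT
  set A := ∑' k₁ : ℤ, 1 / (1 + |(k₁ : ℝ)|) ^ (s₁ * p / (p - 1)) with hA
  set B := ∑' k₂ : Idx d, 1 / (1 + ‖k₂‖) ^ (s₂ * q / (q - 1)) with hB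
  have hA0 : 0 ≤ A := tsum_nonneg fun _ => by positivity
  have hB0 : 0 ≤ B := tsum_nonneg fun _ => by positivity
  let a : ℤ → ℝ≥0∞ := fun k => ENNReal.ofReal ((1 + |z.1 - k|) ^ (-s₁))
  let b : Idx d → ℝ≥0∞ := fun k =>
    ENNReal.ofReal ((1 + ‖z.2 - WithLp.toLp 2 (fun i => (k i : ℝ))‖) ^ (-s₂))
  have ha : (∑ k ∈ S, a k ^ (p / (p - 1))) ≤ ENNReal.ofReal A := by
    refine le_trans ?_ (tsum_one_add_abs_sub_rpow_le h₁ z.1)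
    refine le_trans (ENNReal.sum_le_tsum S) (ENNReal.tsum_le_tsum fun k => ?_)
    simp only [a]
    rw [ENNReal.ofReal_rpow_of_pos (by positivity), ← Real.rpow_mul (by positivity)]
    refine le_of_eq ?_
    congr 2; ring
  have hb : (∑ k ∈ T, b k ^ (q / (q - 1))) ≤ ENNReal.ofReal B := by
    refine le_trans ?_ (tsum_one_add_norm_sub_rpow_le_sup hd h₂ z.2)
    refine le_trans (ENNReal.sum_le_tsum T) (ENNReal.tsum_le_tsum fun k => ?_)
    simp only [b]
    rw [ENNReal.ofReal_rpow_of_pos (by positivity), ← Real.rpow_mul (by positivity)]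
    refine le_of_eq ?_
    congr 2; ring
  have hshift : ∀ i k₁ k₂, ‖shift (Φ i) k₁ k₂ z‖ₑ ≤ ENNReal.ofReal C * (a k₁ * b k₂) := by
    intro i k₁ k₂
    have := hdecay i (z.1 - (k₁ : ℝ), z.2 - WithLp.toLp 2 (fun i => (k₂ i : ℝ)))
    simp only [a, b]
    rw [← ENNReal.ofReal_mul (by positivity), ← ENNReal.ofReal_mul hC.le, ← ofReal_norm]
    apply ENNReal.ofReal_le_ofReal
    refine this.trans_eq ?_
    rw [Real.rpow_neg (by positivity), Real.rpow_neg (by positivity), ← mul_inv, div_eq_mul_inv]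
  have hone : ∀ i, ‖∑ k₁ ∈ S, ∑ k₂ ∈ T, c i k₁ k₂ * shift (Φ i) k₁ k₂ z‖ₑ ≤
      ENNReal.ofReal (C * (A ^ ((p - 1) / p) * B ^ ((q - 1) / q))) * mixedSeqNorm p q (c i) := by
    intro i
    calc _ ≤ ∑ k₁ ∈ S, ∑ k₂ ∈ T, ‖c i k₁ k₂‖ₑ * (ENNReal.ofReal C * (a k₁ * b k₂)) := by
          refine (enorm_sum_le _ _).trans (Finset.sum_le_sum fun k₁ _ => ?_)
          refine (enorm_sum_le _ _).trans (Finset.sum_le_sum fun k₂ _ => ?_)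
          rw [enorm_mul]
          gcongr
          exact hshift i k₁ k₂
      _ = ENNReal.ofReal C * ∑ k₁ ∈ S, ∑ k₂ ∈ T, ‖c i k₁ k₂‖ₑ * (a k₁ * b k₂) := by
          simp_rw [Finset.mul_sum]
          exact Finset.sum_congr rfl fun _ _ => Finset.sum_congr rfl fun _ _ => by ring
      _ ≤ ENNReal.ofReal C * (mixedSeqNorm p q (c i) *
            (ENNReal.ofReal A ^ ((p - 1) / p) * ENNReal.ofReal B ^ ((q - 1) / q))) := by
          refine mul_le_mul_right ((sum_sum_mul_le S T hp hq _ a b).trans ?_) _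
          refine mul_le_mul' ?_ (mul_le_mul' ?_ ?_)
          · unfold mixedSeqNorm
            refine ENNReal.rpow_le_rpow ((Finset.sum_le_sum fun k₁ _ => ?_).trans
              (ENNReal.sum_le_tsum S)) (by positivity)
            exact ENNReal.rpow_le_rpow (ENNReal.sum_le_tsum T) (by positivity)
          · exact ENNReal.rpow_le_rpow ha (by positivity)
          · exact ENNReal.rpow_le_rpow hb (by positivity)
      _ = _ := by
          rw [ENNReal.ofReal_mul hC.le, ENNReal.ofReal_mul (by positivity),
            ENNReal.ofReal_rpow_of_nonneg hA0 (by positivity),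
            ENNReal.ofReal_rpow_of_nonneg hB0 (by positivity)]
          ring
  -- The exponent is `1/p + 1/q ≤ 2`, so the factor `4 / 2^((p+q)/(pq))` of `cStar` is at least `1`.
  -- The argument itself needs only the constant without this factor.
  have hexp : (p + q) / (p * q) ≤ 2 := by
    rw [div_le_iff₀ (by positivity)]
    nlinarith [mul_pos hp1 hq1]
  have h4 : (2 : ℝ) ^ ((p + q) / (p * q)) ≤ 4 := by
    calc (2 : ℝ) ^ ((p + q) / (p * q)) ≤ 2 ^ (2 : ℝ) :=
          Real.rpow_le_rpow_of_exponent_le one_le_two hexp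
      _ = 4 := by norm_num
  have hcst : C * (A ^ ((p - 1) / p) * B ^ ((q - 1) / q)) ≤
      cStar d p q C α₁ s₁ s₂ * α₁ := by
    unfold cStar
    rw [← hA, ← hB]
    have : C ≤ 4 * C / ((2 : ℝ) ^ ((p + q) / (p * q)) * α₁) * α₁ := by
      have h2 : (0:ℝ) < (2 : ℝ) ^ ((p + q) / (p * q)) := by positivity
      field_simp
      linarith
    calc C * (A ^ ((p - 1) / p) * B ^ ((q - 1) / q))
        ≤ (4 * C / ((2 : ℝ) ^ ((p + q) / (p * q)) * α₁) * α₁) *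
          (A ^ ((p - 1) / p) * B ^ ((q - 1) / q)) := by gcongr
      _ = _ := by ring
  have hcs := (cStar_pos d hd hα₁ hC h₁ h₂).le
  calc ‖f z‖ₑ ≤ ∑ i, ENNReal.ofReal (C * (A ^ ((p - 1) / p) * B ^ ((q - 1) / q))) *
        mixedSeqNorm p q (c i) := by
        rw [hz z]
        exact (enorm_sum_le _ _).trans (Finset.sum_le_sum fun i _ => hone i)
    _ = ENNReal.ofReal (C * (A ^ ((p - 1) / p) * B ^ ((q - 1) / q))) *
        ∑ i, mixedSeqNorm p q (c i) := by rw [Finset.mul_sum]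
    _ ≤ ENNReal.ofReal (cStar d p q C α₁ s₁ s₂ * α₁) * ∑ i, mixedSeqNorm p q (c i) := by
        gcongr
    _ = ENNReal.ofReal (cStar d p q C α₁ s₁ s₂) *
        (ENNReal.ofReal α₁ * ∑ i, mixedSeqNorm p q (c i)) := by
        rw [ENNReal.ofReal_mul hcs, mul_assoc]
    _ ≤ _ := by gcongr

lemma mixedNorm_lt_top_of_mem_VN {d r N : ℕ} {p q : ℝ} (hp : 1 < p) (hq : 1 < q)
    {Φ : Fin r → Pt d → ℂ} {α₁ α₂ : ℝ} (hstable : StableShifts p q Φ α₁ α₂)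
    {f : Pt d → ℂ} (hf : f ∈ VN Φ N) : mixedNorm p q f < ∞ := by
  obtain ⟨c, hcfin, hsyn, -⟩ := VN_exists_synthesis hp hq hf
  rw [hsyn]
  refine (hstable c hcfin).2.trans_lt (ENNReal.mul_lt_top ENNReal.ofReal_lt_top ?_)
  exact ENNReal.sum_lt_top.mpr fun i _ => hcfin i

/-! ### Hölder and Young inequalities on the cuboid -/

lemma setLIntegral_le_rpow_mul {α : Type*} [MeasurableSpace α] (ν : Measure α) (S : Set α)
    {q : ℝ} (hq : 1 < q) {g : α → ℝ≥0∞} (hg : Measurable g) :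
    ∫⁻ y in S, g y ∂ν ≤ ν S ^ ((q - 1) / q) * (∫⁻ y, g y ^ q ∂ν) ^ (1 / q) := by
  have hq' : q.HolderConjugate (q / (q - 1)) := Real.HolderConjugate.conjExponent hq
  have hq0 : 0 < q := by linarith
  have h := ENNReal.lintegral_mul_le_Lp_mul_Lq (ν.restrict S) hq' hg.aemeasurable
    (aemeasurable_const (b := (1 : ℝ≥0∞)))
  simp only [Pi.mul_apply, mul_one, ENNReal.one_rpow, lintegral_const, one_mul, one_div_div,
    Measure.restrict_apply_univ] at h
  rw [mul_comm]
  refine h.trans ?_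
  gcongr
  exact Measure.restrict_le_self

lemma volume_box (d : ℕ) {K : ℝ} (hK : 0 < K) :
    volume {y : EuclideanSpace ℝ (Fin d) | ∀ i, |y i| ≤ K} = ENNReal.ofReal ((2 * K) ^ d) := by
  have h := (PiLp.volume_preserving_ofLp (Fin d)).measure_preimage
    (s := Set.pi Set.univ fun _ : Fin d => Set.Icc (-K) K)
    (MeasurableSet.univ_pi fun _ => measurableSet_Icc).nullMeasurableSet
  have e : {y : EuclideanSpace ℝ (Fin d) | ∀ i, |y i| ≤ K} =
      (@WithLp.ofLp 2 (Fin d → ℝ)) ⁻¹' (Set.pi Set.univ fun _ : Fin d => Set.Icc (-K) K) := by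
    ext y
    simp only [Set.mem_ofPred_eq, Set.mem_preimage, Set.mem_pi, Set.mem_univ, true_implies,
      Set.mem_Icc, abs_le]
  rw [e, h, volume_pi_pi]
  simp only [Real.volume_Icc, Finset.prod_const, Finset.card_univ, Fintype.card_fin]
  rw [← ENNReal.ofReal_pow (by linarith)]
  congr 2
  ring

lemma cuboid_eq (d : ℕ) (K₁ K₂ : ℝ) : cuboid d K₁ K₂ =
    Set.Icc (-K₁) K₁ ×ˢ {y : EuclideanSpace ℝ (Fin d) | ∀ i, |y i| ≤ K₂} := by
  ext z
  simp [cuboid, abs_le]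

lemma measurableSet_box (d : ℕ) (K : ℝ) :
    MeasurableSet {y : EuclideanSpace ℝ (Fin d) | ∀ i, |y i| ≤ K} := by
  have : IsClosed {y : EuclideanSpace ℝ (Fin d) | ∀ i, |y i| ≤ K} := by
    simp only [Set.ofPred_forall]
    exact isClosed_iInter fun i => isClosed_le (by fun_prop) continuous_const
  exact this.measurableSet

lemma measurableSet_cuboid (d : ℕ) (K₁ K₂ : ℝ) : MeasurableSet (cuboid d K₁ K₂) := by
  rw [cuboid_eq]
  exact measurableSet_Icc.prod (measurableSet_box d K₂)

/-- Hölder's inequality for mixed norms on a cuboid. -/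
lemma lintegral_cuboid_le {d : ℕ} {p q : ℝ} (hp : 1 < p) (hq : 1 < q) {K₁ K₂ : ℝ}
    (hK₁ : 0 < K₁) (hK₂ : 0 < K₂) {f : Pt d → ℂ} (hf : Measurable f) :
    ∫⁻ z in cuboid d K₁ K₂, ‖f z‖ₑ ≤
      ENNReal.ofReal ((2 * K₁) ^ ((p - 1) / p) * (2 * K₂) ^ ((d : ℝ) * (q - 1) / q)) *
        mixedNorm p q f := by
  have hp0 : 0 < p := by linarith
  have hq0 : 0 < q := by linarith
  have hp1 : 0 < p - 1 := by linarith
  have hq1 : 0 < q - 1 := by linarith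
  have hfe : Measurable fun z : Pt d => ‖f z‖ₑ := hf.enorm
  set B : ℝ≥0∞ := ENNReal.ofReal ((2 * K₂) ^ ((d : ℝ) * (q - 1) / q)) with hB
  have hBv : volume {y : EuclideanSpace ℝ (Fin d) | ∀ i, |y i| ≤ K₂} ^ ((q - 1) / q) = B := by
    rw [volume_box d hK₂, ENNReal.ofReal_rpow_of_pos (by positivity), ← Real.rpow_natCast,
      ← Real.rpow_mul (by positivity), hB, mul_div_assoc]
  rw [cuboid_eq, Measure.volume_eq_prod, ← Measure.prod_restrict,
    lintegral_prod _ hfe.aemeasurable]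
  set G : ℝ → ℝ≥0∞ := fun x => (∫⁻ y : EuclideanSpace ℝ (Fin d), ‖f (x, y)‖ₑ ^ q) ^ (1 / q)
    with hG
  have hGm : Measurable G := by
    have : Measurable fun x => ∫⁻ y : EuclideanSpace ℝ (Fin d), ‖f (x, y)‖ₑ ^ q :=
      Measurable.lintegral_prod_right' (f := fun z : Pt d => ‖f z‖ₑ ^ q) (hfe.pow_const q)
    exact this.pow_const _
  calc ∫⁻ x in Set.Icc (-K₁) K₁, ∫⁻ y in {y : EuclideanSpace ℝ (Fin d) | ∀ i, |y i| ≤ K₂},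
        ‖f (x, y)‖ₑ
      ≤ ∫⁻ x in Set.Icc (-K₁) K₁, B * G x := by
        refine lintegral_mono fun x => ?_
        rw [← hBv]
        exact setLIntegral_le_rpow_mul volume _ hq (hfe.comp measurable_prodMk_left)
    _ = B * ∫⁻ x in Set.Icc (-K₁) K₁, G x := lintegral_const_mul _ hGm
    _ ≤ B * (ENNReal.ofReal ((2 * K₁) ^ ((p - 1) / p)) * mixedNorm p q f) := by
        gcongr
        refine (setLIntegral_le_rpow_mul volume _ hp hGm).trans_eq ?_
        rw [Real.volume_Icc, ENNReal.ofReal_rpow_of_pos (by linarith), mixedNorm]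
        simp only [hG]
        simp_rw [← ENNReal.rpow_mul, one_div_mul_eq_div]
        congr 4
        ring
    _ = _ := by
        rw [ENNReal.ofReal_mul (by positivity)]
        ring

lemma mixedNorm_comp_sub {d : ℕ} (p q : ℝ) (f : Pt d → ℂ) (w : Pt d) :
    mixedNorm p q (fun z => f (z - w)) = mixedNorm p q f := by
  unfold mixedNorm
  have h : ∀ x : ℝ, ∫⁻ y : EuclideanSpace ℝ (Fin d), ‖f ((x, y) - w)‖ₑ ^ q =
      ∫⁻ y : EuclideanSpace ℝ (Fin d), ‖f (x - w.1, y)‖ₑ ^ q := fun x =>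
    lintegral_sub_right_eq_self (fun y => ‖f (x - w.1, y)‖ₑ ^ q) w.2
  simp_rw [h]
  rw [lintegral_sub_right_eq_self
    (fun x => (∫⁻ y : EuclideanSpace ℝ (Fin d), ‖f (x, y)‖ₑ ^ q) ^ (p / q)) w.1]

instance volume_isAddHaarMeasure (d : ℕ) : (volume : Measure (Pt d)).IsAddHaarMeasure :=
  inferInstanceAs (((volume : Measure ℝ).prod
    (volume : Measure (EuclideanSpace ℝ (Fin d)))).IsAddHaarMeasure)

lemma conv_apply {d : ℕ} (f ψ : Pt d → ℂ) (z : Pt d) :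
    conv f ψ z = ∫ w, f (z - w) * ψ w := convolution_mul_swap

lemma continuous_conv {d : ℕ} {f ψ : Pt d → ℂ} (hf : Continuous f)
    (hb : ∃ b, ∀ z, ‖f z‖ ≤ b) (hψ : Integrable ψ) : Continuous (conv f ψ) := by
  obtain ⟨b, hb⟩ := hb
  exact BddAbove.continuous_convolution_left_of_integrable _
    ⟨b, by rintro _ ⟨z, rfl⟩; exact hb z⟩ hf hψ

lemma norm_conv_le {d : ℕ} {f ψ : Pt d → ℂ} {b : ℝ} (hb : ∀ z, ‖f z‖ ≤ b) (hψ : Integrable ψ)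
    (z : Pt d) : ‖conv f ψ z‖ ≤ (∫ w, ‖ψ w‖) * b := by
  rw [conv_apply, ← integral_mul_const]
  refine norm_integral_le_of_norm_le (hψ.norm.mul_const b) (Filter.Eventually.of_forall fun w => ?_)
  rw [norm_mul, mul_comm]
  gcongr
  exact hb _

lemma integrable_conv_integrand {d : ℕ} {f ψ : Pt d → ℂ} (hf : Continuous f)
    (hb : ∃ b, ∀ z, ‖f z‖ ≤ b) (hψ : Integrable ψ) (z : Pt d) :
    Integrable fun w => f (z - w) * ψ w := by
  obtain ⟨b, hb⟩ := hb
  exact hψ.bdd_mul (c := b) (by fun_prop) (Filter.Eventually.of_forall fun w => hb _)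

lemma conv_sum {d : ℕ} {J : Type*} [Fintype J] {g : J → Pt d → ℂ} {ψ : Pt d → ℂ}
    (hg : ∀ j, Continuous (g j)) (hb : ∀ j, ∃ b, ∀ z, ‖g j z‖ ≤ b) (hψ : Integrable ψ)
    (a : J → ℂ) (z : Pt d) :
    conv (fun z => ∑ j, a j * g j z) ψ z = ∑ j, a j * conv (g j) ψ z := by
  simp_rw [conv_apply, Finset.sum_mul, mul_assoc]
  rw [integral_finsetSum]
  · simp_rw [integral_const_mul]
  · intro j _
    exact (integrable_conv_integrand (hg j) (hb j) hψ z).const_mul _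

/-- Young's inequality combined with Hölder's inequality for mixed norms on a cuboid. -/
lemma integral_cuboid_norm_conv_le {d : ℕ} {p q : ℝ} (hp : 1 < p) (hq : 1 < q) {K₁ K₂ : ℝ}
    (hK₁ : 0 < K₁) (hK₂ : 0 < K₂) {f ψ : Pt d → ℂ} (hf : Continuous f)
    (hb : ∃ b, ∀ z, ‖f z‖ ≤ b) (hψ : Integrable ψ) (hfin : mixedNorm p q f < ∞) :
    ∫ z in cuboid d K₁ K₂, ‖conv f ψ z‖ ≤
      (∫ w, ‖ψ w‖) * ((2 * K₁) ^ ((p - 1) / p) * (2 * K₂) ^ ((d : ℝ) * (q - 1) / q)) *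
        (mixedNorm p q f).toReal := by
  set κ : ℝ := (2 * K₁) ^ ((p - 1) / p) * (2 * K₂) ^ ((d : ℝ) * (q - 1) / q) with hκ
  have hκ0 : 0 ≤ κ := by positivity
  have hψ0 : 0 ≤ ∫ w, ‖ψ w‖ := integral_nonneg fun _ => norm_nonneg _
  have key : ∫⁻ z in cuboid d K₁ K₂, ‖conv f ψ z‖ₑ ≤
      ENNReal.ofReal (∫ w, ‖ψ w‖) * (ENNReal.ofReal κ * mixedNorm p q f) := by
    calc ∫⁻ z in cuboid d K₁ K₂, ‖conv f ψ z‖ₑ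
        ≤ ∫⁻ z in cuboid d K₁ K₂, ∫⁻ w, ‖f (z - w)‖ₑ * ‖ψ w‖ₑ := by
          refine lintegral_mono fun z => ?_
          rw [conv_apply]
          refine (enorm_integral_le_lintegral_enorm _).trans_eq ?_
          simp_rw [enorm_mul]
      _ = ∫⁻ w, ∫⁻ z in cuboid d K₁ K₂, ‖f (z - w)‖ₑ * ‖ψ w‖ₑ := by
          refine lintegral_lintegral_swap ?_
          refine AEMeasurable.mul (f := fun z : Pt d × Pt d => ‖f (z.1 - z.2)‖ₑ)
            (g := fun z : Pt d × Pt d => ‖ψ z.2‖ₑ) ?_ ?_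
          · exact (by fun_prop : Continuous fun z : Pt d × Pt d => f (z.1 - z.2)).measurable.enorm.aemeasurable
          · exact hψ.1.enorm.comp_snd
      _ ≤ ∫⁻ w, ‖ψ w‖ₑ * (ENNReal.ofReal κ * mixedNorm p q f) := by
          refine lintegral_mono fun w => ?_
          have hm : Measurable fun z => f (z - w) :=
            (by fun_prop : Continuous fun z => f (z - w)).measurable
          rw [lintegral_mul_const _ hm.enorm, mul_comm]
          gcongr
          -- Hölder is applied to the translate `f (· - w)`, whose mixed norm is that of `f`.
          have := lintegral_cuboid_le hp hq hK₁ hK₂ hm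
          rwa [mixedNorm_comp_sub] at this
      _ = _ := by
          rw [lintegral_mul_const'' _ hψ.1.enorm, ofReal_integral_norm_eq_lintegral_enorm hψ]
  rw [integral_norm_eq_lintegral_enorm (continuous_conv hf hb hψ).aestronglyMeasurable]
  refine (ENNReal.toReal_mono ?_ key).trans_eq ?_
  · exact ENNReal.mul_ne_top ENNReal.ofReal_ne_top
      (ENNReal.mul_ne_top ENNReal.ofReal_ne_top hfin.ne)
  · rw [ENNReal.toReal_mul, ENNReal.toReal_mul, ENNReal.toReal_ofReal hψ0,
      ENNReal.toReal_ofReal hκ0]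
    ring

/-! ### McDiarmid's inequality -/

section Concentration

variable {X : Type*} [MeasurableSpace X] (ν : Measure X) [IsProbabilityMeasure ν]

lemma measurable_fin_cons {n : ℕ} :
    Measurable fun w : X × (Fin n → X) => (Fin.cons w.1 w.2 : Fin (n + 1) → X) := by
  refine measurable_pi_lambda _ fun i => ?_
  refine Fin.cases ?_ (fun j => ?_) i
  · simpa using measurable_fst
  · simp only [Fin.cons_succ]
    exact (measurable_pi_apply j).comp measurable_snd

lemma integral_pi_succ {n : ℕ} (G : (Fin (n + 1) → X) → ℝ) :
    ∫ z, G z ∂(Measure.pi fun _ : Fin (n + 1) => ν) =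
      ∫ w : X × (Fin n → X), G (Fin.cons w.1 w.2) ∂(ν.prod (Measure.pi fun _ : Fin n => ν)) := by
  have := (measurePreserving_piFinSuccAbove (fun _ : Fin (n + 1) => ν) 0).symm
  rw [← this.integral_comp']
  refine integral_congr_ae (Filter.Eventually.of_forall fun w => ?_)
  simp only [MeasurableEquiv.piFinSuccAbove_symm_apply, Fin.insertNthEquiv, Fin.insertNth_zero,
    Equiv.coe_fn_mk]
  rfl

/-- Bounded measurable functions on `X^n` with oscillation at most `c` in each variable. -/
structure BoundedDifferences {n : ℕ} (F : (Fin n → X) → ℝ) (c : ℝ) : Prop where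
  measurable : Measurable F
  bounded : ∃ B, ∀ z, |F z| ≤ B
  diff_le : ∀ i z z', (∀ j, j ≠ i → z j = z' j) → F z - F z' ≤ c

lemma BoundedDifferences.integrable {n : ℕ} {F : (Fin n → X) → ℝ} {c : ℝ}
    (hF : BoundedDifferences F c) : Integrable F (Measure.pi fun _ : Fin n => ν) := by
  obtain ⟨B, hB⟩ := hF.bounded
  exact Integrable.of_bound hF.measurable.aestronglyMeasurable B (Filter.Eventually.of_forall hB)

lemma integrable_exp_mul_of_abs_le {Y : Type*} [MeasurableSpace Y] (π : Measure Y)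
    [IsFiniteMeasure π] {F : Y → ℝ} (hF : Measurable F) {B : ℝ} (hB : ∀ y, |F y| ≤ B) (t : ℝ) :
    Integrable (fun y => Real.exp (t * F y)) π := by
  refine Integrable.of_bound (by fun_prop) (Real.exp (|t| * B)) (Filter.Eventually.of_forall fun y => ?_)
  rw [Real.norm_of_nonneg (Real.exp_pos _).le]
  apply Real.exp_le_exp.mpr
  calc t * F y ≤ |t * F y| := le_abs_self _
    _ = |t| * |F y| := abs_mul _ _
    _ ≤ |t| * B := by gcongr; exact hB y

/-- Induction by integrating out one coordinate. The mean `F'` over the first coordinate again has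
bounded differences and is handled by induction; with the other coordinates fixed, `F - F'` is
centred with range in an interval of length `c`, and Hoeffding's lemma applies. -/
lemma BoundedDifferences.integral_exp_le {n : ℕ} {F : (Fin n → X) → ℝ} {c : ℝ} (hc : 0 ≤ c)
    (hF : BoundedDifferences F c) (t : ℝ) :
    ∫ z, Real.exp (t * (F z - ∫ z', F z' ∂(Measure.pi fun _ : Fin n => ν)))
      ∂(Measure.pi fun _ : Fin n => ν) ≤ Real.exp (n * (c ^ 2 * t ^ 2 / 8)) := by
  induction n with
  | zero =>
    have : ∀ z, F z = F default := fun z => by rw [Subsingleton.elim z default]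
    simp [this]
  | succ n ih =>
    obtain ⟨B, hB⟩ := hF.bounded
    set π := Measure.pi fun _ : Fin n => ν with hπ
    have hm : Measurable fun w : X × (Fin n → X) => F (Fin.cons w.1 w.2) :=
      hF.measurable.comp measurable_fin_cons
    have hm1 : ∀ z, Measurable fun x : X => F (Fin.cons x z) := fun z =>
      hm.comp measurable_prodMk_right
    have hint1 : ∀ z, Integrable (fun x : X => F (Fin.cons x z)) ν := fun z =>
      Integrable.of_bound (hm1 z).aestronglyMeasurable B (Filter.Eventually.of_forall fun _ => hB _)
    set F' : (Fin n → X) → ℝ := fun z => ∫ x, F (Fin.cons x z) ∂ν with hF'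
    have hF'm : Measurable F' :=
      (hm.stronglyMeasurable.integral_prod_left').measurable
    have hF'B : ∀ z, |F' z| ≤ B := by
      intro z
      have := norm_integral_le_of_norm_le_const (μ := ν) (f := fun x => F (Fin.cons x z)) (C := B)
        (Filter.Eventually.of_forall fun _ => hB _)
      simpa using this
    have hbd : BoundedDifferences F' c := by
      refine ⟨hF'm, ⟨B, hF'B⟩, fun i z z' h => ?_⟩
      rw [hF', ← integral_sub (hint1 z) (hint1 z')]
      have : ∀ x, F (Fin.cons x z) - F (Fin.cons x z') ≤ c := by
        intro x
        refine hF.diff_le i.succ _ _ fun j => ?_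
        refine Fin.cases ?_ (fun k hk => ?_) j
        · simp
        · simpa using h k fun e => hk (by rw [e])
      calc _ ≤ ∫ _x, c ∂ν := integral_mono ((hint1 z).sub (hint1 z')) (integrable_const c) this
        _ = c := by simp
    have hmean : ∫ z, F z ∂(Measure.pi fun _ : Fin (n + 1) => ν) = ∫ z, F' z ∂π := by
      rw [integral_pi_succ, integral_prod_symm]
      exact Integrable.of_bound hm.aestronglyMeasurable B (Filter.Eventually.of_forall fun _ => hB _)
    rw [hmean]
    set m := ∫ z, F' z ∂π with hmdef
    have hmB : |m| ≤ B := by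
      have := norm_integral_le_of_norm_le_const (μ := π) (f := F') (C := B)
        (Filter.Eventually.of_forall hF'B)
      simpa using this
    have hinner : ∀ z, ∫ x, Real.exp (t * (F (Fin.cons x z) - F' z)) ∂ν ≤
        Real.exp (c ^ 2 * t ^ 2 / 8) := by
      intro z
      have hbelow : BddBelow (Set.range fun x => F (Fin.cons x z)) :=
        ⟨-B, by rintro _ ⟨x, rfl⟩; exact neg_le_of_abs_le (hB _)⟩
      have hne : Nonempty X := ν.nonempty_of_neZero
      -- Starting the interval at the infimum over the first coordinate gives it length `c`; the
      -- centred interval would have length `2 c` and a worse exponent.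
      have hmem : ∀ x, F (Fin.cons x z) ∈ Set.Icc (⨅ x, F (Fin.cons x z))
          ((⨅ x, F (Fin.cons x z)) + c) := by
        intro x
        refine ⟨ciInf_le hbelow x, ?_⟩
        have : F (Fin.cons x z) - c ≤ ⨅ x, F (Fin.cons x z) := by
          refine le_ciInf fun x' => ?_
          have := hF.diff_le 0 (Fin.cons x z) (Fin.cons x' z) fun j => by
            refine Fin.cases (fun h => absurd rfl h) (fun k _ => by simp) j
          linarith
        linarith
      have h := (hasSubgaussianMGF_of_mem_Icc (μ := ν) (hm1 z).aemeasurable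
        (Filter.Eventually.of_forall hmem)).mgf_le t
      refine h.trans_eq ?_
      congr 1
      simp only [add_sub_cancel_left, NNReal.coe_pow, NNReal.coe_div, coe_nnnorm,
        Real.norm_of_nonneg hc, NNReal.coe_ofNat]
      ring
    have hG : Measurable fun w : X × (Fin n → X) => F (Fin.cons w.1 w.2) - m := hm.sub_const m
    have hGint := integrable_exp_mul_of_abs_le (ν.prod π) hG (B := B + B) (fun w =>
      (abs_sub _ _).trans (add_le_add (hB _) hmB)) t
    rw [integral_pi_succ, integral_prod_symm _ hGint]
    have hsplit : ∀ z, ∫ x, Real.exp (t * (F (Fin.cons x z) - m)) ∂ν =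
        (∫ x, Real.exp (t * (F (Fin.cons x z) - F' z)) ∂ν) * Real.exp (t * (F' z - m)) := by
      intro z
      rw [← integral_mul_const]
      congr 1
      ext x
      rw [← Real.exp_add]
      congr 1; ring
    simp only
    simp_rw [hsplit]
    have hI2 : Integrable (fun z => Real.exp (t * (F' z - m))) π :=
      integrable_exp_mul_of_abs_le π (hF'm.sub_const m) (B := B + B)
        (fun z => (abs_sub _ _).trans (add_le_add (hF'B z) hmB)) t
    calc _ ≤ ∫ z, Real.exp (c ^ 2 * t ^ 2 / 8) * Real.exp (t * (F' z - m)) ∂π := by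
          refine integral_mono_of_nonneg (Filter.Eventually.of_forall fun z => ?_)
            (hI2.const_mul _) (Filter.Eventually.of_forall fun z => ?_)
          · exact mul_nonneg (integral_nonneg fun _ => (Real.exp_pos _).le) (Real.exp_pos _).le
          · exact mul_le_mul_of_nonneg_right (hinner z) (Real.exp_pos _).le
      _ = Real.exp (c ^ 2 * t ^ 2 / 8) * ∫ z, Real.exp (t * (F' z - m)) ∂π :=
          integral_const_mul _ _
      _ ≤ Real.exp (c ^ 2 * t ^ 2 / 8) * Real.exp (n * (c ^ 2 * t ^ 2 / 8)) := by
          gcongr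
          exact ih hbd
      _ = _ := by
          rw [← Real.exp_add]
          congr 1
          push_cast
          ring

/-- **McDiarmid's inequality**. -/
lemma BoundedDifferences.measure_ge_le {n : ℕ} {F : (Fin n → X) → ℝ} {c : ℝ} (hc : 0 ≤ c)
    (hF : BoundedDifferences F c) {t : ℝ} (ht : 0 ≤ t) :
    (Measure.pi fun _ : Fin n => ν).real
      {z | t ≤ F z - ∫ z', F z' ∂(Measure.pi fun _ : Fin n => ν)} ≤
        Real.exp (-(2 * t ^ 2 / (n * c ^ 2))) := by
  obtain ⟨B, hB⟩ := hF.bounded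
  -- The variance proxy `n c² / 4` encodes the moment bound `exp(n c² t² / 8)`.
  have hsub : HasSubgaussianMGF
      (fun z => F z - ∫ z', F z' ∂(Measure.pi fun _ : Fin n => ν))
      (Real.toNNReal (n * c ^ 2 / 4)) (Measure.pi fun _ : Fin n => ν) := by
    refine ⟨fun t => ?_, fun t => ?_⟩
    · refine integrable_exp_mul_of_abs_le _ (hF.measurable.sub_const _)
        (B := B + |∫ z', F z' ∂(Measure.pi fun _ : Fin n => ν)|)
        (fun z => (abs_sub _ _).trans (add_le_add (hB _) le_rfl)) t
    · refine (hF.integral_exp_le ν hc t).trans_eq ?_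
      rw [Real.coe_toNNReal _ (by positivity)]
      congr 1; ring
  refine (hsub.measure_ge_le ht).trans_eq ?_
  rw [Real.coe_toNNReal _ (by positivity)]
  congr 1
  rw [neg_div, show 2 * (n * c ^ 2 / 4) = n * c ^ 2 / 2 by ring, div_div_eq_mul_div]
  ring_nf

end Concentration

/-! ### Suprema of uniformly bounded families -/

lemma bddAbove_range_of_abs_le {A : Type*} {g : A → ℝ} {B : ℝ} (hB : ∀ a, |g a| ≤ B) :
    BddAbove (Set.range g) :=
  ⟨B, by rintro _ ⟨a, rfl⟩; exact (le_abs_self _).trans (hB a)⟩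

lemma abs_integral_le_of_abs_le {X : Type*} [MeasurableSpace X] (ν : Measure X)
    [IsProbabilityMeasure ν] {f : X → ℝ} {B : ℝ} (hB : ∀ x, |f x| ≤ B) :
    |∫ x, f x ∂ν| ≤ B := by
  have := norm_integral_le_of_norm_le_const (μ := ν) (f := f) (C := B)
    (Filter.Eventually.of_forall hB)
  simpa using this

section SupLemmas

variable {A : Type*} {Y : Type*} [TopologicalSpace Y] [MeasurableSpace Y]
  [OpensMeasurableSpace Y]

lemma abs_ciSup_le [Nonempty A] {g : A → ℝ} {B : ℝ} (hB : ∀ a, |g a| ≤ B) : |⨆ a, g a| ≤ B := by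
  have hbdd : BddAbove (Set.range g) := ⟨B, by rintro _ ⟨a, rfl⟩; exact (le_abs_self _).trans (hB a)⟩
  obtain ⟨a⟩ := ‹Nonempty A›
  refine abs_le.mpr ⟨(neg_le_of_abs_le (hB a)).trans (le_ciSup hbdd a), ?_⟩
  exact ciSup_le fun a => (le_abs_self _).trans (hB a)

/-- The index set may be uncountable; a bounded supremum of continuous functions is lower
semicontinuous, hence Borel. -/
lemma measurable_ciSup_of_continuous {g : A → Y → ℝ} (hg : ∀ a, Continuous (g a)) {B : ℝ}
    (hB : ∀ a y, |g a y| ≤ B) : Measurable fun y => ⨆ a, g a y :=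
  (lowerSemicontinuous_ciSup (fun y => bddAbove_range_of_abs_le fun a => hB a y)
    fun a => (hg a).lowerSemicontinuous).measurable

lemma integrable_ciSup [Nonempty A] {g : A → Y → ℝ} (hg : ∀ a, Continuous (g a)) {B : ℝ}
    (hB : ∀ a y, |g a y| ≤ B) (π : Measure Y) [IsFiniteMeasure π] :
    Integrable (fun y => ⨆ a, g a y) π :=
  Integrable.of_bound (measurable_ciSup_of_continuous hg hB).aestronglyMeasurable B
    (Filter.Eventually.of_forall fun y => abs_ciSup_le fun a => hB a y)

end SupLemmas

/-! ### Random signs, symmetrization and contraction -/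

/-- The uniform distribution of a random sign. -/
noncomputable def signMeasure : Measure Bool :=
  (2⁻¹ : ℝ≥0∞) • (Measure.dirac true + Measure.dirac false)

instance : IsProbabilityMeasure signMeasure := by
  refine ⟨?_⟩
  simp only [signMeasure, Measure.smul_apply, Measure.add_apply, measure_univ, smul_eq_mul]
  rw [one_add_one_eq_two, ENNReal.inv_mul_cancel (by simp) (by simp)]

lemma integral_signMeasure (f : Bool → ℝ) : ∫ b, f b ∂signMeasure = (f true + f false) / 2 := by
  rw [signMeasure, integral_smul_measure, integral_add_measure (integrable_dirac (by simp))
    (integrable_dirac (by simp)), integral_dirac, integral_dirac]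
  simp
  ring

/-- The sign `±1` encoded by a boolean. -/
noncomputable def sgn (b : Bool) : ℝ := if b then 1 else -1

lemma abs_sgn (b : Bool) : |sgn b| = 1 := by cases b <;> simp [sgn]

lemma continuous_sgn : Continuous sgn := continuous_of_discreteTopology

section Symmetrization

variable {X : Type*} [TopologicalSpace X] [MeasurableSpace X] [BorelSpace X]
  [SecondCountableTopology X] (ν : Measure X) [IsProbabilityMeasure ν]
  {A : Type*} [Nonempty A] {v : A → X → ℝ} {c : ℝ} {φ : ℝ → ℝ}

/-- Two-point form of the contraction principle. For indices `a`, `b` on the left, `φ (w a) - φ (w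
b)` is at most `|w a - w b|`; the sign of that difference decides which of `a`, `b` is used in which
supremum on the right. -/
lemma ciSup_add_ciSup_le_of_lipschitz (hφ : ∀ s t, |φ s - φ t| ≤ |s - t|) {u w : A → ℝ}
    {B : ℝ} (hu : ∀ a, |u a| ≤ B) (hw : ∀ a, |w a| ≤ c) :
    (⨆ a, (u a + 2 * φ (w a))) + (⨆ a, (u a - 2 * φ (w a))) ≤
      (⨆ a, (u a + 2 * w a)) + ⨆ a, (u a - 2 * w a) := by
  have b1 : BddAbove (Set.range fun a => u a + 2 * w a) :=
    bddAbove_range_of_abs_le (B := B + 2 * c) fun a => by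
      refine (abs_add_le _ _).trans (add_le_add (hu a) ?_)
      rw [abs_mul, abs_two]
      linarith [hw a]
  have b2 : BddAbove (Set.range fun a => u a - 2 * w a) :=
    bddAbove_range_of_abs_le (B := B + 2 * c) fun a => by
      refine (abs_sub _ _).trans (add_le_add (hu a) ?_)
      rw [abs_mul, abs_two]
      linarith [hw a]
  rw [← le_sub_iff_add_le]
  refine ciSup_le fun a => ?_
  rw [le_sub_comm]
  refine ciSup_le fun b => ?_
  have h1 := le_ciSup b1 a
  have h2 := le_ciSup b2 b
  have h3 := le_ciSup b1 b
  have h4 := le_ciSup b2 a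
  have h5 := (le_abs_self _).trans (hφ (w a) (w b))
  rcases abs_cases (w a - w b) with h | h <;> linarith

lemma abs_le_of_lipschitz (hφ : ∀ s t, |φ s - φ t| ≤ |s - t|) {s : ℝ} (hs : |s| ≤ c) :
    |φ s| ≤ |φ 0| + c := by
  have := hφ s 0
  rw [sub_zero] at this
  calc |φ s| = |φ 0 + (φ s - φ 0)| := by ring_nf
    _ ≤ |φ 0| + |φ s - φ 0| := abs_add_le _ _
    _ ≤ _ := by linarith

lemma continuous_of_abs_sub_le (hφ : ∀ s t, |φ s - φ t| ≤ |s - t|) : Continuous φ :=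
  (LipschitzWith.of_dist_le_mul (K := 1) fun s t => by
    rw [Real.dist_eq, Real.dist_eq, NNReal.coe_one, one_mul]
    exact hφ s t).continuous

/-- One step of symmetrization and contraction. -/
lemma integral_ciSup_centered_le (hv : ∀ a, Continuous (v a)) (hvc : ∀ a x, |v a x| ≤ c)
    (hφ : ∀ s t, |φ s - φ t| ≤ |s - t|) {u : A → ℝ} {B : ℝ} (hu : ∀ a, |u a| ≤ B) :
    ∫ x, ⨆ a, (u a + (φ (v a x) - ∫ x', φ (v a x') ∂ν)) ∂ν ≤
      ∫ y : X × Bool, ⨆ a, (u a + 2 * (sgn y.2 * v a y.1)) ∂(ν.prod signMeasure) := by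
  have hφc := continuous_of_abs_sub_le hφ
  set M := |φ 0| + c with hM
  have hφv : ∀ a x, |φ (v a x)| ≤ M := fun a x => abs_le_of_lipschitz hφ (hvc a x)
  have hφvc : ∀ a, Continuous fun x => φ (v a x) := fun a => hφc.comp (hv a)
  have hφi : ∀ a, Integrable (fun x => φ (v a x)) ν := fun a =>
    Integrable.of_bound (hφvc a).aestronglyMeasurable M (Filter.Eventually.of_forall (hφv a))
  have hmean : ∀ a, |∫ x', φ (v a x') ∂ν| ≤ M := fun a => abs_integral_le_of_abs_le ν (hφv a)
  have bA : ∀ a x, |u a + 2 * φ (v a x)| ≤ B + 2 * M := fun a x => by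
    refine (abs_add_le _ _).trans (add_le_add (hu a) ?_)
    rw [abs_mul, abs_two]; linarith [hφv a x]
  have bB : ∀ a x, |u a - 2 * φ (v a x)| ≤ B + 2 * M := fun a x => by
    refine (abs_sub _ _).trans (add_le_add (hu a) ?_)
    rw [abs_mul, abs_two]; linarith [hφv a x]
  have bL : ∀ a x, |u a + (φ (v a x) - ∫ x', φ (v a x') ∂ν)| ≤ B + (M + M) := fun a x => by
    refine (abs_add_le _ _).trans (add_le_add (hu a) ((abs_sub _ _).trans ?_))
    exact add_le_add (hφv a x) (hmean a)
  have b1 : ∀ a (y : X × Bool), |u a + 2 * (sgn y.2 * v a y.1)| ≤ B + 2 * c := fun a y => by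
    refine (abs_add_le _ _).trans (add_le_add (hu a) ?_)
    rw [abs_mul, abs_two, abs_mul, abs_sgn, one_mul]; linarith [hvc a y.1]
  have iA := integrable_ciSup (A := A) (g := fun a x => u a + 2 * φ (v a x))
    (fun a => by have := hφvc a; fun_prop) bA ν
  have iB := integrable_ciSup (A := A) (g := fun a x => u a - 2 * φ (v a x))
    (fun a => by have := hφvc a; fun_prop) bB ν
  have iL := integrable_ciSup (A := A)
    (g := fun a x => u a + (φ (v a x) - ∫ x', φ (v a x') ∂ν))
    (fun a => by have := hφvc a; fun_prop) bL ν
  have i1 := integrable_ciSup (A := A) (Y := X × Bool)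
    (g := fun a y => u a + 2 * (sgn y.2 * v a y.1))
    (fun a => by have := hv a; have := continuous_sgn; fun_prop) b1 (ν.prod signMeasure)
  set IB := ∫ x, ⨆ a, (u a - 2 * φ (v a x)) ∂ν with hIB
  -- The centred term is the average of `u + 2 φ` and `u - 2 E φ`. The mean in the second can be
  -- pulled out of the supremum by Jensen, so no second sample has to be introduced.
  have hpt : ∀ x, ⨆ a, (u a + (φ (v a x) - ∫ x', φ (v a x') ∂ν)) ≤
      2⁻¹ * (⨆ a, (u a + 2 * φ (v a x))) + 2⁻¹ * IB := by
    intro x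
    refine ciSup_le fun a => ?_
    have h1 : u a + 2 * φ (v a x) ≤ ⨆ a, (u a + 2 * φ (v a x)) :=
      le_ciSup (bddAbove_range_of_abs_le fun a => bA a x) a
    have h2 : u a - 2 * ∫ x', φ (v a x') ∂ν ≤ IB := by
      have e : u a - 2 * ∫ x', φ (v a x') ∂ν = ∫ x', (u a - 2 * φ (v a x')) ∂ν := by
        rw [integral_sub (integrable_const _) ((hφi a).const_mul 2), integral_const_mul]
        simp
      rw [e]
      exact integral_mono ((integrable_const _).sub ((hφi a).const_mul 2)) iB fun x' =>
        le_ciSup (bddAbove_range_of_abs_le fun a => bB a x') a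
    linarith
  have hAB : ∀ x, (⨆ a, (u a + 2 * φ (v a x))) + (⨆ a, (u a - 2 * φ (v a x))) ≤
      2 * ∫ b, (⨆ a, (u a + 2 * (sgn b * v a x))) ∂signMeasure := by
    intro x
    refine (ciSup_add_ciSup_le_of_lipschitz hφ hu fun a => hvc a x).trans_eq ?_
    rw [integral_signMeasure]
    simp only [sgn, if_true, one_mul, Bool.false_eq_true, if_false, neg_mul, mul_neg,
      ← sub_eq_add_neg]
    ring
  calc _ ≤ ∫ x, (2⁻¹ * (⨆ a, (u a + 2 * φ (v a x))) + 2⁻¹ * IB) ∂ν :=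
        integral_mono iL ((iA.const_mul _).add (integrable_const _)) hpt
    _ = 2⁻¹ * ∫ x, ((⨆ a, (u a + 2 * φ (v a x))) + ⨆ a, (u a - 2 * φ (v a x))) ∂ν := by
        rw [integral_add (iA.const_mul _) (integrable_const _), integral_const_mul,
          integral_add iA iB]
        simp
        ring
    _ ≤ 2⁻¹ * ∫ x, (2 * ∫ b, (⨆ a, (u a + 2 * (sgn b * v a x))) ∂signMeasure) ∂ν := by
        exact mul_le_mul_of_nonneg_left
          (integral_mono (iA.add iB) (i1.integral_prod_left.const_mul 2) hAB) (by norm_num)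
    _ = _ := by
        rw [integral_const_mul, integral_prod _ i1]
        ring

lemma abs_sum_fin_le {n : ℕ} {f : Fin n → ℝ} {B : ℝ} (h : ∀ j, |f j| ≤ B) :
    |∑ j, f j| ≤ n * B := by
  refine (Finset.abs_sum_le_sum_abs _ _).trans ((Finset.sum_le_sum fun j _ => h j).trans_eq ?_)
  simp

/-- Symmetrization and contraction for suprema of empirical processes. -/
lemma integral_ciSup_sum_centered_le (hv : ∀ a, Continuous (v a)) (hvc : ∀ a x, |v a x| ≤ c)
    (hφ : ∀ s t, |φ s - φ t| ≤ |s - t|) (n : ℕ) {u : A → ℝ} {B : ℝ} (hu : ∀ a, |u a| ≤ B) :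
    ∫ z, ⨆ a, (u a + ∑ j, (φ (v a (z j)) - ∫ x', φ (v a x') ∂ν))
        ∂(Measure.pi fun _ : Fin n => ν) ≤
      ∫ y : Fin n → X × Bool, ⨆ a, (u a + ∑ j, 2 * (sgn (y j).2 * v a (y j).1))
        ∂(Measure.pi fun _ : Fin n => ν.prod signMeasure) := by
  have hφc := continuous_of_abs_sub_le hφ
  set M := |φ 0| + c with hM
  have hφv : ∀ a x, |φ (v a x)| ≤ M := fun a x => abs_le_of_lipschitz hφ (hvc a x)
  have hφvc : ∀ a, Continuous fun x => φ (v a x) := fun a => hφc.comp (hv a)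
  have hmean : ∀ a, |∫ x', φ (v a x') ∂ν| ≤ M := fun a => abs_integral_le_of_abs_le ν (hφv a)
  set h : A → X → ℝ := fun a x => φ (v a x) - ∫ x', φ (v a x') ∂ν with hh
  have hhc : ∀ a, Continuous (h a) := fun a => by have := hφvc a; fun_prop
  have hhB : ∀ a x, |h a x| ≤ M + M := fun a x =>
    (abs_sub _ _).trans (add_le_add (hφv a x) (hmean a))
  set w : A → X × Bool → ℝ := fun a y => 2 * (sgn y.2 * v a y.1) with hw
  have hwc : ∀ a, Continuous (w a) := fun a => by
    have := hv a; have := continuous_sgn; fun_prop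
  have hwB : ∀ a y, |w a y| ≤ 2 * c := fun a y => by
    simp only [hw]
    rw [abs_mul, abs_two, abs_mul, abs_sgn, one_mul]
    linarith [hvc a y.1]
  -- The arbitrary offset `u` drives the induction: the first coordinate is absorbed in it while the
  -- others are symmetrized, and after exchanging the integrals the symmetrized coordinates are
  -- absorbed while the first is treated.
  induction n generalizing u B with
  | zero => simp
  | succ n ih =>
    set π := Measure.pi fun _ : Fin n => ν
    set π' := Measure.pi fun _ : Fin n => ν.prod signMeasure
    rw [integral_pi_succ, integral_pi_succ]
    simp only [Fin.sum_univ_succ, Fin.cons_zero, Fin.cons_succ]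
    have i1 := integrable_ciSup (A := A) (Y := X × (Fin n → X))
      (g := fun a z => u a + (h a z.1 + ∑ j, h a (z.2 j)))
      (fun a => by have := hhc a; fun_prop)
      (B := B + ((M + M) + n * (M + M)))
      (fun a z => (abs_add_le _ _).trans (add_le_add (hu a) ((abs_add_le _ _).trans
        (add_le_add (hhB a _) (abs_sum_fin_le fun j => hhB a _))))) (ν.prod π)
    have i2 := integrable_ciSup (A := A) (Y := X × (Fin n → X × Bool))
      (g := fun a z => u a + h a z.1 + ∑ j, w a (z.2 j))
      (fun a => by have := hhc a; have := hwc a; fun_prop)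
      (B := B + (M + M) + n * (2 * c))
      (fun a z => (abs_add_le _ _).trans (add_le_add ((abs_add_le _ _).trans
        (add_le_add (hu a) (hhB a _))) (abs_sum_fin_le fun j => hwB a _))) (ν.prod π')
    have i3 := integrable_ciSup (A := A) (Y := (X × Bool) × (Fin n → X × Bool))
      (g := fun a z => u a + (w a z.1 + ∑ j, w a (z.2 j)))
      (fun a => by have := hwc a; fun_prop)
      (B := B + (2 * c + n * (2 * c)))
      (fun a z => (abs_add_le _ _).trans (add_le_add (hu a) ((abs_add_le _ _).trans
        (add_le_add (hwB a _) (abs_sum_fin_le fun j => hwB a _)))))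
      ((ν.prod signMeasure).prod π')
    calc _ = ∫ x, ∫ z : Fin n → X, ⨆ a, (u a + h a x + ∑ j, h a (z j)) ∂π ∂ν := by
          rw [integral_prod _ i1]
          simp only [add_assoc]
      _ ≤ ∫ x, ∫ y : Fin n → X × Bool, ⨆ a, (u a + h a x + ∑ j, w a (y j)) ∂π' ∂ν := by
          refine integral_mono ?_ i2.integral_prod_left fun x => ?_
          · have := i1.integral_prod_left
            simpa only [add_assoc] using this
          · exact ih (u := fun a => u a + h a x) (B := B + (M + M)) fun a =>
              (abs_add_le _ _).trans (add_le_add (hu a) (hhB a x))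
      _ = ∫ y : Fin n → X × Bool, ∫ x, ⨆ a, ((u a + ∑ j, w a (y j)) + h a x) ∂ν ∂π' := by
          rw [integral_integral_swap i2]
          simp only [add_right_comm]
      _ ≤ ∫ y : Fin n → X × Bool, ∫ y₀, ⨆ a, ((u a + ∑ j, w a (y j)) + w a y₀)
            ∂(ν.prod signMeasure) ∂π' := by
          refine integral_mono ?_ ?_ fun y => ?_
          · have := i2.integral_prod_right
            refine this.congr (Filter.Eventually.of_forall fun y => ?_)
            simp only [add_right_comm]
          · have := i3.integral_prod_right
            refine this.congr (Filter.Eventually.of_forall fun y => ?_)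
            simp only [add_assoc, add_comm (w _ _)]
          · exact integral_ciSup_centered_le ν hv hvc hφ
              (u := fun a => u a + ∑ j, w a (y j)) (B := B + n * (2 * c)) fun a =>
              (abs_add_le _ _).trans (add_le_add (hu a) (abs_sum_fin_le fun j => hwB a _))
      _ = _ := by
          rw [integral_prod_symm _ i3]
          simp only [add_assoc, add_comm (w _ _)]

end Symmetrization

/-! ### Mean of the supremum over a linear class -/

section LinearClass

variable {X : Type*} [MeasurableSpace X] (ν : Measure X) [IsProbabilityMeasure ν]

lemma integral_prod_signMeasure_sgn_mul (w : X → ℝ) :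
    ∫ y : X × Bool, sgn y.2 * w y.1 ∂(ν.prod signMeasure) = 0 := by
  have h := integral_prod_mul (μ := ν) (ν := signMeasure) w sgn
  simp_rw [mul_comm (sgn _)]
  rw [h, integral_signMeasure]
  simp [sgn]

lemma memLp_sgn_mul {X : Type*} [MeasurableSpace X] (ν : Measure X) {w : X → ℝ}
    (hw : MemLp w 2 ν) :
    MemLp (fun y : X × Bool => sgn y.2 * w y.1) 2 (ν.prod signMeasure) := by
  have h1 : MemLp (fun y : X × Bool => w y.1) 2 (ν.prod signMeasure) := hw.comp_fst signMeasure
  refine h1.of_le ?_ (Filter.Eventually.of_forall fun y => ?_)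
  · exact (continuous_sgn.measurable.comp measurable_snd).aestronglyMeasurable.mul h1.1
  · rw [norm_mul, Real.norm_eq_abs, abs_sgn, one_mul]

/-- The random signs make the independent summands centred, so the second moment of the sum is a sum
of variances. -/
lemma integral_sq_sum_sgn_mul {w : X → ℝ} (hw : MemLp w 2 ν) (n : ℕ) :
    ∫ y : Fin n → X × Bool, (∑ j, sgn (y j).2 * w (y j).1) ^ 2
      ∂(Measure.pi fun _ : Fin n => ν.prod signMeasure) = n * ∫ x, w x ^ 2 ∂ν := by
  have hm := memLp_sgn_mul ν hw
  have hint0 := integral_prod_signMeasure_sgn_mul ν w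
  have hv := variance_sum_pi (μ := fun _ : Fin n => ν.prod signMeasure)
    (X := fun _ y => sgn y.2 * w y.1) (fun _ => hm)
  have hmi : ∀ i : Fin n, Integrable (fun y : Fin n → X × Bool => sgn (y i).2 * w (y i).1)
      (Measure.pi fun _ : Fin n => ν.prod signMeasure) := fun i =>
    (measurePreserving_eval (fun _ : Fin n => ν.prod signMeasure) i).integrable_comp_of_integrable
      (hm.integrable (by norm_num))
  have hsum0 : ∫ y : Fin n → X × Bool, (∑ j, sgn (y j).2 * w (y j).1)
      ∂(Measure.pi fun _ : Fin n => ν.prod signMeasure) = 0 := by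
    rw [integral_finsetSum _ fun i _ => hmi i]
    refine Finset.sum_eq_zero fun i _ => ?_
    have := integral_comp_eval (μ := fun _ : Fin n => ν.prod signMeasure) (i := i)
      (f := fun y : X × Bool => sgn y.2 * w y.1) hm.1
    rw [this, hint0]
  have haem : AEMeasurable (fun y : Fin n → X × Bool => ∑ j, sgn (y j).2 * w (y j).1)
      (Measure.pi fun _ : Fin n => ν.prod signMeasure) :=
    (integrable_finsetSum _ fun i _ => hmi i).aemeasurable
  have e : (∑ i : Fin n, fun ω : Fin n → X × Bool => sgn (ω i).2 * w (ω i).1) =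
      fun y : Fin n → X × Bool => ∑ j, sgn (y j).2 * w (y j).1 := by
    ext; simp
  rw [e, variance_of_integral_eq_zero haem hsum0] at hv
  rw [hv]
  have h2 : Var[fun y : X × Bool => sgn y.2 * w y.1; ν.prod signMeasure] = ∫ x, w x ^ 2 ∂ν := by
    rw [variance_of_integral_eq_zero hm.1.aemeasurable hint0]
    have : ∀ y : X × Bool, (sgn y.2 * w y.1) ^ 2 = w y.1 ^ 2 := fun y => by
      rw [mul_pow, ← sq_abs (sgn _), abs_sgn]; ring
    simp_rw [this]
    exact integral_fun_fst (μ := ν) (ν := signMeasure) (fun x => w x ^ 2) |>.trans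
      (by rw [probReal_univ, one_smul])
  simp [h2]

/-- Expected supremum of the centered empirical process of a contraction of a linear class which is
bounded in `L²`. -/
lemma integral_ciSup_centered_linear_le [TopologicalSpace X] [BorelSpace X]
    [SecondCountableTopology X] {A : Type*} [Nonempty A] {v : A → X → ℝ} {c : ℝ}
    (hc : 0 ≤ c) {φ : ℝ → ℝ} (hv : ∀ a, Continuous (v a)) (hvc : ∀ a x, |v a x| ≤ c)
    (hφ : ∀ s t, |φ s - φ t| ≤ |s - t|) {L : Type*} [Fintype L] {w : L → X → ℝ}
    (hw : ∀ l, MemLp (w l) 2 ν) {D : ℝ} (hD : ∑ l, ∫ x, w l x ^ 2 ∂ν ≤ D) {β : A → L → ℝ}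
    (hβ : ∀ a, ∑ l, β a l ^ 2 ≤ c ^ 2) (hvw : ∀ᵐ x ∂ν, ∀ a, v a x = ∑ l, β a l * w l x) (n : ℕ) :
    ∫ z, ⨆ a, (∑ j, (φ (v a (z j)) - ∫ x', φ (v a x') ∂ν)) ∂(Measure.pi fun _ : Fin n => ν) ≤
      2 * c * √(n * D) := by
  have h := integral_ciSup_sum_centered_le ν hv hvc hφ n (u := fun _ => 0) (B := 0) (by simp)
  simp only [zero_add] at h
  refine h.trans ?_
  set π' := Measure.pi fun _ : Fin n => ν.prod signMeasure with hπ'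
  -- Cauchy–Schwarz in `l` separates the coefficients `β`, which carry the index `a`, from the
  -- randomness: the supremum is at most `2 c √R`, and `R` no longer depends on `a`.
  set R : (Fin n → X × Bool) → ℝ := fun y => ∑ l, (∑ j, sgn (y j).2 * w l (y j).1) ^ 2 with hR
  have hR0 : ∀ y, 0 ≤ R y := fun y => Finset.sum_nonneg fun _ _ => sq_nonneg _
  have hmem : ∀ l, MemLp (fun y : Fin n → X × Bool => ∑ j, sgn (y j).2 * w l (y j).1) 2 π' :=
    fun l => memLp_finsetSum _ fun i _ =>
      (memLp_sgn_mul ν (hw l)).comp_measurePreserving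
        (measurePreserving_eval (fun _ : Fin n => ν.prod signMeasure) i)
  have hRi : Integrable R π' := integrable_finsetSum _ fun l _ => (hmem l).integrable_sq
  have hRint : ∫ y, R y ∂π' ≤ n * D := by
    rw [hR, integral_finsetSum _ fun l _ => (hmem l).integrable_sq]
    simp_rw [hπ', integral_sq_sum_sgn_mul ν (hw _) n]
    rw [← Finset.mul_sum]
    gcongr
  have hsqi : Integrable (fun y => √(R y)) π' := by
    refine (hRi.add (integrable_const 1)).mono' ?_ (Filter.Eventually.of_forall fun y => ?_)
    · exact Real.continuous_sqrt.comp_aestronglyMeasurable hRi.1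
    · rw [Real.norm_of_nonneg (Real.sqrt_nonneg _)]
      simp only [Pi.add_apply]
      rw [Real.sqrt_le_iff]
      constructor <;> nlinarith [hR0 y]
  -- Jensen for the square root, read off from the nonnegativity of the variance of `√R`.
  have hsq : ∫ y, √(R y) ∂π' ≤ √(∫ y, R y ∂π') := by
    apply Real.le_sqrt_of_sq_le
    have hmemR : MemLp (fun y => √(R y)) 2 π' := by
      rw [memLp_two_iff_integrable_sq hsqi.1]
      refine hRi.congr (Filter.Eventually.of_forall fun y => ?_)
      simp only
      rw [Real.sq_sqrt (hR0 y)]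
    have hvar := variance_nonneg (fun y => √(R y)) π'
    rw [variance_eq_sub hmemR] at hvar
    have e : (fun y => √(R y)) ^ 2 = R := by
      ext y
      simp [Real.sq_sqrt (hR0 y)]
    rw [e] at hvar
    linarith
  have hae : ∀ᵐ y ∂π', ∀ j, ∀ a, v a (y j).1 = ∑ l, β a l * w l (y j).1 := by
    rw [ae_all_iff]
    intro j
    have h1 : ∀ᵐ y ∂(ν.prod signMeasure), ∀ a, v a y.1 = ∑ l, β a l * w l y.1 :=
      (measurePreserving_fst (μ := ν) (ν := signMeasure)).quasiMeasurePreserving.ae hvw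
    exact (measurePreserving_eval
      (fun _ : Fin n => ν.prod signMeasure) j).quasiMeasurePreserving.ae h1
  have hpt : ∀ᵐ y ∂π', ⨆ a, (∑ j, 2 * (sgn (y j).2 * v a (y j).1)) ≤ 2 * c * √(R y) := by
    filter_upwards [hae] with y hy
    refine ciSup_le fun a => ?_
    have e : ∑ j, 2 * (sgn (y j).2 * v a (y j).1) =
        2 * ∑ l, β a l * ∑ j, sgn (y j).2 * w l (y j).1 := by
      simp_rw [Finset.mul_sum]
      rw [Finset.sum_comm]
      refine Finset.sum_congr rfl fun j _ => ?_
      rw [hy j a, Finset.mul_sum, Finset.mul_sum]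
      exact Finset.sum_congr rfl fun l _ => by ring
    rw [e, mul_assoc]
    gcongr
    refine (Real.sum_mul_le_sqrt_mul_sqrt _ _ _).trans ?_
    gcongr
    exact Real.sqrt_le_iff.mpr ⟨hc, hβ a⟩
  have hint := integrable_ciSup (A := A) (Y := Fin n → X × Bool)
    (g := fun a y => ∑ j, 2 * (sgn (y j).2 * v a (y j).1)) (B := n * (2 * c))
    (fun a => by have := hv a; have := continuous_sgn; fun_prop)
    (fun a y => abs_sum_fin_le fun j => by
      rw [abs_mul, abs_two, abs_mul, abs_sgn, one_mul]
      linarith [hvc a (y j).1]) π'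
  calc _ ≤ ∫ y, 2 * c * √(R y) ∂π' := integral_mono_ae hint (hsqi.const_mul _) hpt
    _ = 2 * c * ∫ y, √(R y) ∂π' := integral_const_mul _ _
    _ ≤ 2 * c * √(n * D) := by
        gcongr
        exact hsq.trans (Real.sqrt_le_sqrt hRint)

end LinearClass

/-! ### Orthonormal expansion in `L²` -/

lemma coeFn_sum_Lp {X : Type*} [MeasurableSpace X] {ν : Measure X} {J : Type*} (s : Finset J)
    (F : J → Lp ℂ 2 ν) : ⇑(∑ j ∈ s, F j) =ᵐ[ν] fun x => ∑ j ∈ s, F j x := by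
  classical
  induction s using Finset.induction_on with
  | empty =>
    filter_upwards [Lp.coeFn_zero ℂ 2 ν] with x hx
    simpa using hx
  | insert j s hj ih =>
    rw [Finset.sum_insert hj]
    filter_upwards [Lp.coeFn_add (F j) (∑ j ∈ s, F j), ih] with x h1 h2
    rw [h1, Finset.sum_insert hj, Pi.add_apply, h2]

/-- Simultaneous orthonormal expansion of finitely many square integrable functions. -/
lemma exists_orthonormal_expansion {X : Type*} [MeasurableSpace X] (ν : Measure X) {J : Type*}
    [Fintype J] {g : J → X → ℂ} (hg : ∀ j, MemLp (g j) 2 ν) :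
    ∃ (m : ℕ) (e : Fin m → X → ℂ) (b : J → Fin m → ℂ), m ≤ Fintype.card J ∧
      (∀ k, MemLp (e k) 2 ν) ∧ (∀ k, ∫ x, ‖e k x‖ ^ 2 ∂ν = 1) ∧
      (∀ᵐ x ∂ν, ∀ j, g j x = ∑ k, b j k * e k x) ∧
      ∀ a : J → ℂ, ∑ k, ‖∑ j, a j * b j k‖ ^ 2 = ∫ x, ‖∑ j, a j * g j x‖ ^ 2 ∂ν := by
  set G : J → Lp ℂ 2 ν := fun j => (hg j).toLp (g j) with hG
  set W : Submodule ℂ (Lp ℂ 2 ν) := Submodule.span ℂ (Set.range G) with hW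
  have : FiniteDimensional ℂ W := FiniteDimensional.span_of_finite ℂ (Set.finite_range G)
  have hmem : ∀ j, G j ∈ W := fun j => Submodule.subset_span ⟨j, rfl⟩
  let E := stdOrthonormalBasis ℂ W
  have hsqnorm : ∀ f : Lp ℂ 2 ν, ‖f‖ ^ 2 = ∫ x, ‖f x‖ ^ 2 ∂ν := by
    intro f
    have h1 : inner ℂ f f = ((‖f‖ ^ 2 : ℝ) : ℂ) := by
      rw [inner_self_eq_norm_sq_to_K]; simp
    rw [L2.inner_def] at h1
    have h2 : ∀ x, inner ℂ (f x) (f x) = ((‖f x‖ ^ 2 : ℝ) : ℂ) := fun x => by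
      rw [inner_self_eq_norm_sq_to_K]; simp
    simp_rw [h2] at h1
    rw [integral_complex_ofReal] at h1
    exact_mod_cast h1.symm
  -- The basis is one of the span `W`, so linearly dependent `g j` do no harm: `m` is the dimension
  -- of `W` and the last claim is Parseval's identity there.
  refine ⟨Module.finrank ℂ W, fun k => ((E k : W) : Lp ℂ 2 ν), fun j k => E.repr ⟨G j, hmem j⟩ k,
    finrank_range_le_card G, fun k => Lp.memLp _, fun k => ?_, ?_, fun a => ?_⟩
  · rw [← hsqnorm]
    have := E.orthonormal.1 k
    rw [Submodule.norm_coe, this, one_pow]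
  · rw [ae_all_iff]
    intro j
    have h1 : G j = ∑ k, E.repr ⟨G j, hmem j⟩ k • ((E k : W) : Lp ℂ 2 ν) := by
      have := congrArg (Submodule.subtype W) (E.sum_repr ⟨G j, hmem j⟩)
      simpa using this.symm
    have h2 := coeFn_sum_Lp Finset.univ
      fun k => E.repr ⟨G j, hmem j⟩ k • ((E k : W) : Lp ℂ 2 ν)
    rw [← h1] at h2
    have h3 : ∀ᵐ x ∂ν, ∀ k, (E.repr ⟨G j, hmem j⟩ k • ((E k : W) : Lp ℂ 2 ν) : Lp ℂ 2 ν) x =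
        E.repr ⟨G j, hmem j⟩ k * ((E k : W) : Lp ℂ 2 ν) x :=
      ae_all_iff.mpr fun k => Lp.coeFn_smul _ _
    filter_upwards [h2, h3, (hg j).coeFn_toLp] with x hx hx3 hx2
    rw [← hx2]
    exact hx.trans (Finset.sum_congr rfl fun k _ => hx3 k)
  · have h1 : ∀ k, ∑ j, a j * E.repr ⟨G j, hmem j⟩ k = E.repr (∑ j, a j • ⟨G j, hmem j⟩) k := by
      intro k
      rw [map_sum]
      simp_rw [map_smul]
      simp only [WithLp.ofLp_sum, WithLp.ofLp_smul, Finset.sum_apply, Pi.smul_apply, smul_eq_mul]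
    simp_rw [h1]
    rw [← EuclideanSpace.norm_sq_eq, LinearIsometryEquiv.norm_map, ← Submodule.norm_coe, hsqnorm]
    refine integral_congr_ae ?_
    have h2 : ((∑ j, a j • (⟨G j, hmem j⟩ : W) : W) : Lp ℂ 2 ν) = ∑ j, a j • G j := by simp
    rw [h2]
    have h3 : ∀ᵐ x ∂ν, ∀ j, (a j • G j : Lp ℂ 2 ν) x = a j * G j x :=
      ae_all_iff.mpr fun j => Lp.coeFn_smul _ _
    have h4 : ∀ᵐ x ∂ν, ∀ j, G j x = g j x := ae_all_iff.mpr fun j => (hg j).coeFn_toLp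
    filter_upwards [coeFn_sum_Lp Finset.univ fun j => a j • G j, h3, h4] with x hx hx3 hx4
    rw [hx]
    simp_rw [hx3, hx4]

/-! ### The modulus as an average of real parts -/

lemma abs_cos_periodic : Function.Periodic (fun θ : ℝ => |Real.cos θ|) (2 * Real.pi) := fun θ => by
  simp only [Real.cos_add_two_pi]

lemma integral_abs_cos : ∫ θ in (-(Real.pi / 2))..(3 * Real.pi / 2), |Real.cos θ| = 4 := by
  have hpi := Real.pi_pos
  have hi : ∀ a b : ℝ, IntervalIntegrable (fun θ => |Real.cos θ|) volume a b := fun a b =>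
    (Real.continuous_cos.abs).intervalIntegrable a b
  rw [← intervalIntegral.integral_add_adjacent_intervals (hi _ (Real.pi / 2)) (hi _ _)]
  have h1 : ∫ θ in (-(Real.pi / 2))..(Real.pi / 2), |Real.cos θ| =
      ∫ θ in (-(Real.pi / 2))..(Real.pi / 2), Real.cos θ := by
    refine intervalIntegral.integral_congr fun θ hθ => ?_
    rw [Set.uIcc_of_le (by linarith)] at hθ
    exact abs_of_nonneg (Real.cos_nonneg_of_mem_Icc hθ)
  have h2 : ∫ θ in (Real.pi / 2)..(3 * Real.pi / 2), |Real.cos θ| =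
      ∫ θ in (Real.pi / 2)..(3 * Real.pi / 2), -Real.cos θ := by
    refine intervalIntegral.integral_congr fun θ hθ => ?_
    rw [Set.uIcc_of_le (by linarith)] at hθ
    exact abs_of_nonpos (Real.cos_nonpos_of_pi_div_two_le_of_le hθ.1 (by linarith [hθ.2]))
  rw [h1, h2, intervalIntegral.integral_neg, integral_cos, integral_cos, Real.sin_neg,
    Real.sin_pi_div_two, show 3 * Real.pi / 2 = Real.pi / 2 + Real.pi by ring, Real.sin_add_pi,
    Real.sin_pi_div_two]
  norm_num

/-- The modulus of a complex number as the mean of the moduli of its one dimensional projections. -/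
lemma integral_abs_re_exp_mul (ζ : ℂ) :
    ∫ θ in (-(Real.pi / 2))..(3 * Real.pi / 2), |(Complex.exp (-(θ * Complex.I)) * ζ).re| =
      4 * ‖ζ‖ := by
  have h : ∀ θ : ℝ, |(Complex.exp (-(θ * Complex.I)) * ζ).re| =
      ‖ζ‖ * |Real.cos (θ - ζ.arg)| := by
    intro θ
    conv_lhs => rw [← Complex.norm_mul_exp_arg_mul_I ζ]
    rw [mul_left_comm, ← Complex.exp_add, Complex.re_ofReal_mul, abs_mul, abs_norm,
      show -(θ * Complex.I) + ζ.arg * Complex.I = ((ζ.arg - θ : ℝ) : ℂ) * Complex.I by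
        push_cast; ring, Complex.exp_ofReal_mul_I_re, ← Real.cos_neg, neg_sub]
  simp_rw [h]
  rw [intervalIntegral.integral_const_mul,
    intervalIntegral.integral_comp_sub_right (fun θ => |Real.cos θ|) ζ.arg]
  have := abs_cos_periodic.intervalIntegral_add_eq (-(Real.pi / 2) - ζ.arg) (-(Real.pi / 2))
  rw [show -(Real.pi / 2) + 2 * Real.pi = 3 * Real.pi / 2 by ring,
    show -(Real.pi / 2) - ζ.arg + 2 * Real.pi = 3 * Real.pi / 2 - ζ.arg by ring] at this
  rw [this, integral_abs_cos, mul_comm]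

/-! ### Uniform concentration for moduli of a complex class -/

section ComplexClass

variable {X : Type*} [TopologicalSpace X] [MeasurableSpace X] [BorelSpace X]
  [SecondCountableTopology X] (ν : Measure X) [IsProbabilityMeasure ν]
  {J : Type*} [Fintype J] {g : J → X → ℂ} {S : Set (J → ℂ)} {c : ℝ}

/-- The real part of `∑ β_k e_k` is a real combination of the `2m` functions `Re e_k`, `Im e_k`.
Their second moments add up to `m ≤ card J`, not `2m`, and by Parseval the squared coefficients add
up to at most `c²`. -/
lemma integral_ciSup_re_le (hg : ∀ j, Continuous (g j)) (hgb : ∀ j, ∃ b, ∀ x, ‖g j x‖ ≤ b)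
    (hS : S.Nonempty) (hc : 0 ≤ c) (hSc : ∀ a ∈ S, ∀ x, ‖∑ j, a j * g j x‖ ≤ c)
    {σ : ℝ} (hσ : |σ| = 1) (n : ℕ) :
    ∫ z, ⨆ a : S, (∑ i, (σ * |(∑ j, a.1 j * g j (z i)).re| -
        ∫ x, σ * |(∑ j, a.1 j * g j x).re| ∂ν)) ∂(Measure.pi fun _ : Fin n => ν) ≤
      2 * c * √(n * Fintype.card J) := by
  have : Nonempty S := hS.to_subtype
  have hmem : ∀ j, MemLp (g j) 2 ν := fun j => by
    obtain ⟨b, hb⟩ := hgb j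
    exact MemLp.of_bound (hg j).aestronglyMeasurable b (Filter.Eventually.of_forall hb)
  obtain ⟨m, e, b, hm, he, he1, hge, hnorm⟩ := exists_orthonormal_expansion ν hmem
  have hre : ∀ k, MemLp (fun x => (e k x).re) 2 ν := fun k => (he k).re
  have him : ∀ k, MemLp (fun x => (e k x).im) 2 ν := fun k => (he k).im
  refine integral_ciSup_centered_linear_le ν (A := S)
    (v := fun a x => (∑ j, a.1 j * g j x).re) (φ := fun s => σ * |s|) hc
    (fun a => ?_) (fun a x => ?_) (fun s t => ?_) (L := Fin m ⊕ Fin m)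
    (w := Sum.elim (fun k x => (e k x).re) (fun k x => (e k x).im)) ?_ (D := Fintype.card J) ?_
    (β := fun a => Sum.elim (fun k => (∑ j, a.1 j * b j k).re)
      (fun k => -(∑ j, a.1 j * b j k).im)) (fun a => ?_) ?_ n
  · have := hg
    fun_prop
  · exact (Complex.abs_re_le_norm _).trans (hSc a.1 a.2 x)
  · rw [← mul_sub, abs_mul, hσ, one_mul]
    exact abs_abs_sub_abs_le _ _
  · rintro (k | k)
    · exact hre k
    · exact him k
  · rw [Fintype.sum_sum_type]
    simp only [Sum.elim_inl, Sum.elim_inr]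
    rw [← Finset.sum_add_distrib]
    have : ∀ k, ∫ x, (e k x).re ^ 2 ∂ν + ∫ x, (e k x).im ^ 2 ∂ν = 1 := by
      intro k
      rw [← integral_add (hre k).integrable_sq (him k).integrable_sq, ← he1 k]
      congr 1
      ext x
      rw [← Complex.normSq_eq_norm_sq, Complex.normSq_apply]
      ring
    simp only [this, Finset.sum_const, Finset.card_univ, Fintype.card_fin, nsmul_eq_mul, mul_one]
    exact_mod_cast hm
  · rw [Fintype.sum_sum_type]
    simp only [Sum.elim_inl, Sum.elim_inr]
    rw [← Finset.sum_add_distrib]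
    have h1 : ∀ k, (∑ j, a.1 j * b j k).re ^ 2 + (-(∑ j, a.1 j * b j k).im) ^ 2 =
        ‖∑ j, a.1 j * b j k‖ ^ 2 := fun k => by
      rw [← Complex.normSq_eq_norm_sq, Complex.normSq_apply]
      ring
    simp_rw [h1]
    rw [hnorm]
    calc ∫ x, ‖∑ j, a.1 j * g j x‖ ^ 2 ∂ν ≤ ∫ _x, c ^ 2 ∂ν := by
          refine integral_mono_of_nonneg (Filter.Eventually.of_forall fun _ => by positivity)
            (integrable_const _) (Filter.Eventually.of_forall fun x => ?_)
          exact pow_le_pow_left₀ (norm_nonneg _) (hSc a.1 a.2 x) 2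
      _ = c ^ 2 := by simp
  · filter_upwards [hge] with x hx a
    rw [Fintype.sum_sum_type]
    simp only [Sum.elim_inl, Sum.elim_inr]
    rw [← Finset.sum_add_distrib]
    have : ∑ j, a.1 j * g j x = ∑ k, (∑ j, a.1 j * b j k) * e k x := by
      simp_rw [hx, Finset.mul_sum, Finset.sum_mul]
      rw [Finset.sum_comm]
      simp_rw [mul_assoc]
    rw [this, Complex.re_sum]
    refine Finset.sum_congr rfl fun k _ => ?_
    rw [Complex.mul_re]
    ring

/-- The modulus `|ζ|` is a quarter of the integral of `|Re (e^(-iθ) ζ)|` over a period. Each rotated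
coefficient vector stays in `S`, so each `θ` contributes at most the supremum; the period `2π` over
`4` gives `π / 2`. Signs `σ = ±1` serve the two one-sided deviations. -/
lemma sum_norm_sub_integral_le (hg : ∀ j, Continuous (g j))
    (hSc : ∀ a ∈ S, ∀ x, ‖∑ j, a j * g j x‖ ≤ c)
    (hSθ : ∀ a ∈ S, ∀ θ : ℝ, Complex.exp (-(θ * Complex.I)) • a ∈ S)
    {σ : ℝ} (hσ : |σ| = 1) {n : ℕ} (z : Fin n → X) {a : J → ℂ} (ha : a ∈ S) :
    ∑ i, (σ * ‖∑ j, a j * g j (z i)‖ - ∫ x, σ * ‖∑ j, a j * g j x‖ ∂ν) ≤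
      Real.pi / 2 * ⨆ a : S, (∑ i, (σ * |(∑ j, a.1 j * g j (z i)).re| -
        ∫ x, σ * |(∑ j, a.1 j * g j x).re| ∂ν)) := by
  have hpi := Real.pi_pos
  set G : X → ℂ := fun x => ∑ j, a j * g j x with hG
  have hGc : Continuous G := by have := hg; fun_prop
  set Z := ⨆ a : S, (∑ i, (σ * |(∑ j, a.1 j * g j (z i)).re| -
        ∫ x, σ * |(∑ j, a.1 j * g j x).re| ∂ν)) with hZ
  have hbd : ∀ b : S, ∀ x, abs (σ * |(∑ j, b.1 j * g j x).re|) ≤ c := fun b x => by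
    rw [abs_mul, hσ, one_mul, abs_abs]
    exact (Complex.abs_re_le_norm _).trans (hSc b.1 b.2 x)
  have hbdd : BddAbove (Set.range fun a : S => (∑ i, (σ * |(∑ j, a.1 j * g j (z i)).re| -
        ∫ x, σ * |(∑ j, a.1 j * g j x).re| ∂ν))) :=
    bddAbove_range_of_abs_le (B := n * (c + c)) fun b => abs_sum_fin_le fun i =>
      (abs_sub _ _).trans (add_le_add (hbd b _) (abs_integral_le_of_abs_le ν (hbd b)))
  set τ : Measure ℝ := volume.restrict (Set.Ioc (-(Real.pi / 2)) (3 * Real.pi / 2)) with hτ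
  have hle : -(Real.pi / 2) ≤ 3 * Real.pi / 2 := by linarith
  have hproj : ∀ ζ : ℂ, ∫ θ, |(Complex.exp (-((θ : ℝ) * Complex.I)) * ζ).re| ∂τ = 4 * ‖ζ‖ := fun ζ => by
    rw [← integral_abs_re_exp_mul ζ, intervalIntegral.integral_of_le hle]
  have hcont : Continuous fun y : X × ℝ =>
      |(Complex.exp (-((y.2 : ℝ) * Complex.I)) * G y.1).re| := by
    fun_prop
  have hint : Integrable (fun y : X × ℝ =>
      |(Complex.exp (-((y.2 : ℝ) * Complex.I)) * G y.1).re|) (ν.prod τ) := by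
    refine Integrable.of_bound hcont.aestronglyMeasurable c (Filter.Eventually.of_forall fun y => ?_)
    rw [Real.norm_eq_abs, abs_abs]
    refine (Complex.abs_re_le_norm _).trans ?_
    rw [norm_mul, ← neg_mul, ← Complex.ofReal_neg, Complex.norm_exp_ofReal_mul_I, one_mul]
    exact hSc a ha y.1
  have hθi : ∀ x, Integrable (fun θ : ℝ => |(Complex.exp (-((θ : ℝ) * Complex.I)) * G x).re|) τ := by
    intro x
    have hc' : Continuous fun θ : ℝ => |(Complex.exp (-((θ : ℝ) * Complex.I)) * G x).re| := by fun_prop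
    exact (hc'.integrableOn_Icc).mono_set Set.Ioc_subset_Icc_self
  have hswap : 4 * ∫ x, ‖G x‖ ∂ν =
      ∫ θ, ∫ x, |(Complex.exp (-((θ : ℝ) * Complex.I)) * G x).re| ∂ν ∂τ := by
    rw [← integral_integral_swap hint, ← integral_const_mul]
    exact integral_congr_ae (Filter.Eventually.of_forall fun x => (hproj (G x)).symm)
  have hmean : Integrable (fun θ : ℝ =>
      ∫ x, |(Complex.exp (-((θ : ℝ) * Complex.I)) * G x).re| ∂ν) τ := hint.integral_prod_right
  have hmain : 4 * ∑ i, (σ * ‖G (z i)‖ - ∫ x, σ * ‖G x‖ ∂ν) =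
      ∫ θ, ∑ i, (σ * |(Complex.exp (-((θ : ℝ) * Complex.I)) * G (z i)).re| -
        ∫ x, σ * |(Complex.exp (-((θ : ℝ) * Complex.I)) * G x).re| ∂ν) ∂τ := by
    simp_rw [integral_const_mul]
    have hs : ∀ i ∈ Finset.univ, Integrable (fun θ : ℝ =>
        σ * |(Complex.exp (-((θ : ℝ) * Complex.I)) * G (z i)).re| -
          σ * ∫ x, |(Complex.exp (-((θ : ℝ) * Complex.I)) * G x).re| ∂ν) τ := fun i _ =>
      ((hθi (z i)).const_mul σ).sub (hmean.const_mul σ)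
    rw [integral_finsetSum _ hs, Finset.mul_sum]
    refine Finset.sum_congr rfl fun i _ => ?_
    rw [integral_sub ((hθi (z i)).const_mul σ) (hmean.const_mul σ), integral_const_mul,
      integral_const_mul, hproj, ← hswap]
    ring
  have hθ : ∀ θ : ℝ, ∑ i, (σ * |(Complex.exp (-((θ : ℝ) * Complex.I)) * G (z i)).re| -
        ∫ x, σ * |(Complex.exp (-((θ : ℝ) * Complex.I)) * G x).re| ∂ν) ≤ Z := by
    intro θ
    have := le_ciSup hbdd ⟨_, hSθ a ha θ⟩
    simp only [Pi.smul_apply, smul_eq_mul, mul_assoc] at this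
    simpa only [hG, Finset.mul_sum] using this
  have hτm : τ.real Set.univ = 2 * Real.pi := by
    rw [hτ, measureReal_restrict_apply_univ, Real.volume_real_Ioc_of_le hle]
    ring
  have hfin : ∫ θ, ∑ i, (σ * |(Complex.exp (-((θ : ℝ) * Complex.I)) * G (z i)).re| -
        ∫ x, σ * |(Complex.exp (-((θ : ℝ) * Complex.I)) * G x).re| ∂ν) ∂τ ≤ ∫ _θ, Z ∂τ := by
    refine integral_mono (integrable_finsetSum _ fun i _ =>
      ((hθi (z i)).const_mul σ).sub ?_) (integrable_const _) hθ
    simp_rw [integral_const_mul]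
    exact hmean.const_mul σ
  rw [integral_const, hτm, smul_eq_mul, ← hmain] at hfin
  linarith

/-- Uniform concentration of empirical means of the moduli of the members of a `D`-dimensional
complex class that is bounded by `c`. -/
lemma exists_measurableSet_concentration (hg : ∀ j, Continuous (g j))
    (hgb : ∀ j, ∃ b, ∀ x, ‖g j x‖ ≤ b) (hS : S.Nonempty) (hc : 0 < c)
    (hSc : ∀ a ∈ S, ∀ x, ‖∑ j, a j * g j x‖ ≤ c)
    (hSθ : ∀ a ∈ S, ∀ θ : ℝ, Complex.exp (-(θ * Complex.I)) • a ∈ S)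
    {n : ℕ} (hn : 0 < n) {η : ℝ} (hη : 0 < η)
    (hD : 16 * Real.pi ^ 2 * c ^ 2 * Fintype.card J ≤ 9 * η ^ 2 * n) :
    ∃ E : Set (Fin n → X), MeasurableSet E ∧
      (Measure.pi fun _ : Fin n => ν).real E ≤ 2 * Real.exp (-(n * η ^ 2 / (8 * c ^ 2))) ∧
      ∀ z ∉ E, ∀ a ∈ S,
        |∑ i, ‖∑ j, a j * g j (z i)‖ - n * ∫ x, ‖∑ j, a j * g j x‖ ∂ν| ≤ n * η := by
  have : Nonempty S := hS.to_subtype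
  have hn' : (0 : ℝ) < n := by exact_mod_cast hn
  have hpi := Real.pi_pos
  set π := Measure.pi fun _ : Fin n => ν with hπ
  let F : ℝ → (Fin n → X) → ℝ := fun σ z =>
    ⨆ a : S, ∑ i, (σ * ‖∑ j, a.1 j * g j (z i)‖ - ∫ x, σ * ‖∑ j, a.1 j * g j x‖ ∂ν)
  have hcont : ∀ a : S, Continuous fun x => ∑ j, a.1 j * g j x := fun a => by
    have := hg; fun_prop
  have hb : ∀ σ : ℝ, |σ| = 1 → ∀ a : S, ∀ x, |σ * ‖∑ j, a.1 j * g j x‖| ≤ c := by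
    intro σ hσ a x
    rw [abs_mul, hσ, one_mul, abs_norm]
    exact hSc a.1 a.2 x
  have hsum : ∀ σ : ℝ, |σ| = 1 → ∀ (a : S) (z : Fin n → X),
      |∑ i, (σ * ‖∑ j, a.1 j * g j (z i)‖ - ∫ x, σ * ‖∑ j, a.1 j * g j x‖ ∂ν)| ≤ n * (c + c) :=
    fun σ hσ a z => abs_sum_fin_le fun i =>
      (abs_sub _ _).trans (add_le_add (hb σ hσ a _) (abs_integral_le_of_abs_le ν (hb σ hσ a)))
  have hcF : ∀ σ : ℝ, ∀ a : S, Continuous fun z : Fin n → X =>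
      ∑ i, (σ * ‖∑ j, a.1 j * g j (z i)‖ - ∫ x, σ * ‖∑ j, a.1 j * g j x‖ ∂ν) := by
    intro σ a
    have := hcont a
    have h2 : ∀ i : Fin n, Continuous fun z : Fin n → X => ‖∑ j, a.1 j * g j (z i)‖ := fun i =>
      (this.comp (continuous_apply i)).norm
    fun_prop
  have hBD : ∀ σ : ℝ, |σ| = 1 → BoundedDifferences (F σ) c := by
    intro σ hσ
    refine ⟨measurable_ciSup_of_continuous (hcF σ) (hsum σ hσ),
      ⟨_, fun z => abs_ciSup_le fun a => hsum σ hσ a z⟩, fun i z z' h => ?_⟩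
    rw [sub_le_iff_le_add]
    refine ciSup_le fun a => ?_
    have h1 : ∑ i, (σ * ‖∑ j, a.1 j * g j (z' i)‖ - ∫ x, σ * ‖∑ j, a.1 j * g j x‖ ∂ν) ≤ F σ z' :=
      le_ciSup (bddAbove_range_of_abs_le fun a => hsum σ hσ a z') a
    have h2 : ∑ i, (σ * ‖∑ j, a.1 j * g j (z i)‖ - ∫ x, σ * ‖∑ j, a.1 j * g j x‖ ∂ν) -
        ∑ i, (σ * ‖∑ j, a.1 j * g j (z' i)‖ - ∫ x, σ * ‖∑ j, a.1 j * g j x‖ ∂ν) =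
        σ * (‖∑ j, a.1 j * g j (z i)‖ - ‖∑ j, a.1 j * g j (z' i)‖) := by
      rw [← Finset.sum_sub_distrib, Finset.sum_eq_single i]
      · ring
      · intro k _ hk
        rw [h k hk]; ring
      · simp
    -- Both moduli lie in `[0, c]`, so their difference is at most `c`, not `2 c`.
    have h3 : σ * (‖∑ j, a.1 j * g j (z i)‖ - ‖∑ j, a.1 j * g j (z' i)‖) ≤ c := by
      refine (le_abs_self _).trans ?_
      rw [abs_mul, hσ, one_mul]
      exact abs_sub_le_of_nonneg_of_le (norm_nonneg _) (hSc a.1 a.2 _) (norm_nonneg _)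
        (hSc a.1 a.2 _)
    linarith
  -- The bounds multiply to `π c √(n card J)`; squaring turns the claim into `hD`.
  have hEF : ∀ σ : ℝ, |σ| = 1 → ∫ z, F σ z ∂π ≤ 3 / 4 * (n * η) := by
    intro σ hσ
    have hbre : ∀ (a : S) (x : X), abs (σ * |(∑ j, a.1 j * g j x).re|) ≤ c := fun a x => by
      rw [abs_mul, hσ, one_mul, abs_abs]
      exact (Complex.abs_re_le_norm _).trans (hSc a.1 a.2 x)
    have hi := integrable_ciSup (A := S) (Y := Fin n → X)
      (g := fun a z => ∑ i, (σ * |(∑ j, a.1 j * g j (z i)).re| -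
        ∫ x, σ * |(∑ j, a.1 j * g j x).re| ∂ν)) (B := n * (c + c))
      (fun a => by
        have h2 : ∀ i : Fin n, Continuous fun z : Fin n → X => |(∑ j, a.1 j * g j (z i)).re| :=
          fun i => (Complex.continuous_re.comp ((hcont a).comp (continuous_apply i))).abs
        fun_prop)
      (fun a z => abs_sum_fin_le fun i => (abs_sub _ _).trans
        (add_le_add (hbre a _) (abs_integral_le_of_abs_le ν (hbre a)))) π
    calc ∫ z, F σ z ∂π ≤ ∫ z, Real.pi / 2 * ⨆ a : S, (∑ i, (σ * |(∑ j, a.1 j * g j (z i)).re| -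
          ∫ x, σ * |(∑ j, a.1 j * g j x).re| ∂ν)) ∂π := by
          refine integral_mono ((hBD σ hσ).integrable ν) (hi.const_mul _) fun z => ?_
          exact ciSup_le fun a => sum_norm_sub_integral_le ν hg hSc hSθ hσ z a.2
      _ ≤ Real.pi / 2 * (2 * c * √(n * Fintype.card J)) := by
          rw [integral_const_mul]
          gcongr
          exact integral_ciSup_re_le ν hg hgb hS hc.le hSc hσ n
      _ = Real.pi * c * √(n * Fintype.card J) := by ring
      _ ≤ 3 / 4 * (n * η) := by
          rw [← Real.sqrt_sq (mul_pos hpi hc).le, ← Real.sqrt_mul (by positivity)]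
          refine Real.sqrt_le_iff.mpr ⟨by positivity, ?_⟩
          nlinarith
  -- McDiarmid with the remaining quarter: `2 (nη/4)² / (n c²) = n η² / (8 c²)`.
  have hMc : ∀ σ : ℝ, |σ| = 1 → π.real {z | n * η / 4 ≤ F σ z - ∫ z', F σ z' ∂π} ≤
      Real.exp (-(n * η ^ 2 / (8 * c ^ 2))) := by
    intro σ hσ
    refine ((hBD σ hσ).measure_ge_le ν hc.le (by positivity)).trans_eq ?_
    congr 2
    field_simp
    ring
  have hmeas : ∀ σ : ℝ, |σ| = 1 → MeasurableSet {z | n * η / 4 ≤ F σ z - ∫ z', F σ z' ∂π} :=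
    fun σ hσ => measurableSet_le measurable_const ((hBD σ hσ).measurable.sub_const _)
  have h1 : |(1 : ℝ)| = 1 := abs_one
  have h2 : |(-1 : ℝ)| = 1 := by simp
  refine ⟨{z | n * η / 4 ≤ F 1 z - ∫ z', F 1 z' ∂π} ∪ {z | n * η / 4 ≤ F (-1) z - ∫ z', F (-1) z' ∂π},
    (hmeas 1 h1).union (hmeas (-1) h2), ?_, fun z hz a ha => ?_⟩
  · refine (measureReal_union_le _ _).trans ?_
    linarith [hMc 1 h1, hMc (-1) h2]
  · rw [Set.mem_union, not_or] at hz
    have key : ∀ σ : ℝ, |σ| = 1 → ¬ (n * η / 4 ≤ F σ z - ∫ z', F σ z' ∂π) →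
        σ * (∑ i, ‖∑ j, a j * g j (z i)‖ - n * ∫ x, ‖∑ j, a j * g j x‖ ∂ν) ≤ n * η := by
      intro σ hσ hlt
      have hle : ∑ i, (σ * ‖∑ j, a j * g j (z i)‖ - ∫ x, σ * ‖∑ j, a j * g j x‖ ∂ν) ≤ F σ z :=
        le_ciSup (bddAbove_range_of_abs_le fun a => hsum σ hσ a z) ⟨a, ha⟩
      rw [Finset.sum_sub_distrib, ← Finset.mul_sum, integral_const_mul] at hle
      simp only [Finset.sum_const, Finset.card_univ, Fintype.card_fin, nsmul_eq_mul] at hle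
      have := hEF σ hσ
      push Not at hlt
      linarith
    have k1 := key 1 h1 hz.1
    have k2 := key (-1) h2 hz.2
    exact abs_le.mpr ⟨by linarith, by linarith⟩

end ComplexClass

/-! ### Comparison of constants -/

/-- The sample size needed for the expected supremum to be at most `3 η / 4`. -/
lemma sample_size_bound {c η M D : ℝ} (hc : 0 < c) (hη : 0 < η) (hD : 1 ≤ D)
    (hM : 54 * D * √2 * Real.log 2 / η * (2 + 81 / η) < M)
    (hA : 2 * Real.exp (D * Real.log (4 * c + 1)) *
      Real.exp (-(M * (3 * η ^ 2 / (4 * c * (6 * c + η))))) < 1) :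
    16 * Real.pi ^ 2 * c ^ 2 * D ≤ 9 * η ^ 2 * M := by
  have hpi : Real.pi ^ 2 ≤ 10 := by nlinarith [Real.pi_lt_d2, Real.pi_pos]
  have hlog : 0.69 < Real.log 2 := by linarith [Real.log_two_gt_d9]
  have hsqrt : 1.4 < √2 := Real.lt_sqrt_of_sq_lt (by norm_num)
  have hM0 : 0 < M := lt_trans (by positivity) hM
  -- For `c ≤ 10`, `hM` gives `η² M > 54 · 0.9 · 81 D`, and nine times this exceeds `16 · 10 · 100
  -- D`. For `c > 10`, `log (4c+1) ≥ 3`, so `hA` forces `24 c² D ≤ η² M`, and `9 · 24 > 16 · 10`.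
  rcases le_or_gt c 10 with h | h
  · have h1 : 54 * D * √2 * Real.log 2 * (2 * η + 81) < M * η ^ 2 := by
      have : 54 * D * √2 * Real.log 2 / η * (2 + 81 / η) * η ^ 2 =
          54 * D * √2 * Real.log 2 * (2 * η + 81) := by
        field_simp
      rw [← this]
      gcongr
    have h2 : 0.9 ≤ √2 * Real.log 2 := by nlinarith
    have h3 : 54 * D * 0.9 * 81 ≤ 54 * D * √2 * Real.log 2 * (2 * η + 81) := by
      rw [mul_assoc (54 * D) √2]
      have h81 : 81 ≤ 2 * η + 81 := by linarith
      exact mul_le_mul (mul_le_mul_of_nonneg_left h2 (by linarith)) h81 (by norm_num)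
        (by positivity)
    have h4 : c ^ 2 ≤ 100 := by nlinarith
    calc 16 * Real.pi ^ 2 * c ^ 2 * D ≤ 16 * 10 * 100 * D := by gcongr
      _ ≤ 9 * η ^ 2 * M := by nlinarith
  · have h1 : Real.exp (D * Real.log (4 * c + 1) + -(M * (3 * η ^ 2 / (4 * c * (6 * c + η))))) <
        1 := by
      rw [Real.exp_add]
      have := mul_pos (Real.exp_pos (D * Real.log (4 * c + 1)))
        (Real.exp_pos (-(M * (3 * η ^ 2 / (4 * c * (6 * c + η))))))
      nlinarith
    rw [Real.exp_lt_one_iff] at h1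
    have h2 : 3 ≤ Real.log (4 * c + 1) := by
      rw [Real.le_log_iff_exp_le (by linarith)]
      have : Real.exp 3 = Real.exp 1 ^ 3 := by rw [← Real.exp_nat_mul]; norm_num
      rw [this]
      calc Real.exp 1 ^ 3 ≤ 2.8 ^ 3 := by
            gcongr
            linarith [Real.exp_one_lt_d9]
        _ ≤ 4 * c + 1 := by norm_num; linarith
    have h3 : 3 * η ^ 2 / (4 * c * (6 * c + η)) ≤ η ^ 2 / (8 * c ^ 2) := by
      rw [div_le_div_iff₀ (by positivity) (by positivity)]
      have : 0 ≤ 4 * c * η ^ 3 := by positivity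
      nlinarith
    have h4 : M * (3 * η ^ 2 / (4 * c * (6 * c + η))) ≤ M * (η ^ 2 / (8 * c ^ 2)) := by gcongr
    have h5 : D * 3 ≤ D * Real.log (4 * c + 1) := by gcongr
    have h6 : D * 3 ≤ M * (η ^ 2 / (8 * c ^ 2)) := by linarith
    rw [← mul_div_assoc, le_div_iff₀ (by positivity)] at h6
    have h7 : 16 * Real.pi ^ 2 * c ^ 2 * D ≤ 16 * 10 * c ^ 2 * D := by gcongr
    nlinarith [mul_pos (pow_pos hc 2) (lt_of_lt_of_le one_pos hD)]

/-- The exponent on the right is the weaker one because `24 c² ≤ 4 c (6 c + η)`, and the dimensional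
prefactor on the right is at least `1`. -/
lemma tail_le {c η M D : ℝ} (hc : 0 < c) (hη : 0 < η) (hM : 0 ≤ M) (hD : 0 ≤ D) :
    2 * Real.exp (-(M * η ^ 2 / (8 * c ^ 2))) ≤ 2 * Real.exp (D * Real.log (4 * c + 1)) *
      Real.exp (-(M * (3 * η ^ 2 / (4 * c * (6 * c + η))))) := by
  have h3 : 3 * η ^ 2 / (4 * c * (6 * c + η)) ≤ η ^ 2 / (8 * c ^ 2) := by
    rw [div_le_div_iff₀ (by positivity) (by positivity)]
    have : 0 ≤ 4 * c * η ^ 3 := by positivity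
    nlinarith
  have h4 : M * (3 * η ^ 2 / (4 * c * (6 * c + η))) ≤ M * (η ^ 2 / (8 * c ^ 2)) := by gcongr
  have h5 : 0 ≤ D * Real.log (4 * c + 1) :=
    mul_nonneg hD (Real.log_nonneg (by linarith))
  rw [mul_assoc, ← Real.exp_add]
  gcongr
  rw [mul_div_assoc]
  linarith

/-! ### Sampling law, independent array and generators -/

lemma volume_cuboid_lt_top (d : ℕ) (K₁ : ℝ) {K₂ : ℝ} (hK₂ : 0 < K₂) :
    volume (cuboid d K₁ K₂) < ∞ := by
  rw [cuboid_eq, Measure.volume_eq_prod, Measure.prod_prod, volume_box d hK₂]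
  exact ENNReal.mul_lt_top (by simp) ENNReal.ofReal_lt_top

/-- Comparison of a law with bounded density with Lebesgue measure. -/
lemma integral_withDensity_bounds {X : Type*} [TopologicalSpace X] [MeasurableSpace X]
    [OpensMeasurableSpace X] (τ : Measure X) [IsFiniteMeasure τ] {ρ : X → ℝ} {c₁ c₂ : ℝ}
    (hc₁ : 0 ≤ c₁) (hc₂ : 0 ≤ c₂) (hρ : ∀ᵐ z ∂τ, c₁ ≤ ρ z ∧ ρ z ≤ c₂) {h : X → ℝ}
    (hh : Continuous h) {b : ℝ} (hb : ∀ x, h x ≤ b) (h0 : ∀ x, 0 ≤ h x) :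
    c₁ * ∫ z, h z ∂τ ≤ ∫ z, h z ∂(τ.withDensity fun z => ENNReal.ofReal (ρ z)) ∧
      ∫ z, h z ∂(τ.withDensity fun z => ENNReal.ofReal (ρ z)) ≤ c₂ * ∫ z, h z ∂τ := by
  have hle : τ.withDensity (fun z => ENNReal.ofReal (ρ z)) ≤ ENNReal.ofReal c₂ • τ := by
    rw [← withDensity_const]
    exact withDensity_mono (hρ.mono fun z hz => ENNReal.ofReal_le_ofReal hz.2)
  have hge : ENNReal.ofReal c₁ • τ ≤ τ.withDensity (fun z => ENNReal.ofReal (ρ z)) := by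
    rw [← withDensity_const]
    exact withDensity_mono (hρ.mono fun z hz => ENNReal.ofReal_le_ofReal hz.1)
  have hi : Integrable h τ := Integrable.of_bound hh.measurable.aestronglyMeasurable b
    (Filter.Eventually.of_forall fun x => by rw [Real.norm_of_nonneg (h0 x)]; exact hb x)
  have hi2 : Integrable h (ENNReal.ofReal c₂ • τ) := hi.smul_measure ENNReal.ofReal_ne_top
  have e : ∀ t : ℝ, 0 ≤ t → ∫ z, h z ∂(ENNReal.ofReal t • τ) = t * ∫ z, h z ∂τ := fun t ht => by
    rw [integral_smul_measure, ENNReal.toReal_ofReal ht, smul_eq_mul]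
  rw [← e c₁ hc₁, ← e c₂ hc₂]
  exact ⟨integral_mono_measure hge (Filter.Eventually.of_forall h0) (hi2.mono_measure hle),
    integral_mono_measure hle (Filter.Eventually.of_forall h0) hi2⟩

/-- Transport of a uniform statement on samples of size `n * m` to an independent array. -/
lemma exists_event_of_iIndepFun {Y : Type*} [MeasurableSpace Y] {Ω : Type*} [MeasurableSpace Ω]
    (P : Measure Ω) [IsProbabilityMeasure P] {X : ℕ → ℕ → Ω → Y} (hX : ∀ j k, Measurable (X j k))
    (hindep : iIndepFun (fun jk : ℕ × ℕ => X jk.1 jk.2) P) {ν : Measure Y}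
    (hlaw : ∀ j k, P.map (X j k) = ν) (n m : ℕ) {E : Set (Fin (n * m) → Y)}
    (hE : MeasurableSet E) {δ : ℝ} (hδ : (Measure.pi fun _ : Fin (n * m) => ν).real E ≤ δ) :
    ∃ B : Set Ω, MeasurableSet B ∧ P.real B ≤ δ ∧ ∀ ω ∉ B, ∃ z ∉ E, ∀ F : Y → ℝ,
      ∑ i, F (z i) = ∑ j ∈ Finset.Icc 1 n, ∑ k ∈ Finset.Icc 1 m, F (X j k ω) := by
  set I := Finset.Icc 1 n ×ˢ Finset.Icc 1 m with hI
  have hcard : I.card = n * m := by simp [hI]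
  let e : I ≃ Fin (n * m) := Finset.equivFinOfCardEq hcard
  let Z : Ω → Fin (n * m) → Y := fun ω i => X (e.symm i).1.1 (e.symm i).1.2 ω
  have hZ : Measurable Z := measurable_pi_lambda _ fun i => hX _ _
  have hinj : Function.Injective fun i : Fin (n * m) => (e.symm i).1 :=
    Subtype.val_injective.comp e.symm.injective
  have hind : iIndepFun (fun i : Fin (n * m) => X (e.symm i).1.1 (e.symm i).1.2) P :=
    hindep.precomp hinj
  have hmap : P.map Z = Measure.pi fun _ : Fin (n * m) => ν := by
    have := (iIndepFun_iff_map_fun_eq_pi_map (fun i => (hX _ _).aemeasurable)).mp hind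
    simp_rw [hlaw] at this
    exact this
  refine ⟨Z ⁻¹' E, hZ hE, ?_, fun ω hω => ⟨Z ω, hω, fun F => ?_⟩⟩
  · rw [← hmap, map_measureReal_apply hZ hE] at hδ
    exact hδ
  · rw [← Finset.sum_product', ← hI, ← Finset.sum_coe_sort I]
    exact Fintype.sum_equiv e.symm _ _ fun i => rfl

/-- The index set of the generators of `V_N`. -/
abbrev GenIdx (d r N : ℕ) : Type :=
  Fin r × (Finset.Icc (-(N : ℤ)) N) ×
    (Fintype.piFinset fun _ : Fin d => Finset.Icc (-(N : ℤ)) (N : ℤ))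

lemma card_genIdx (d r N : ℕ) : Fintype.card (GenIdx d r N) = r * (2 * N + 1) ^ (d + 1) := by
  have h : (Finset.Icc (-(N : ℤ)) N).card = 2 * N + 1 := by
    rw [Int.card_Icc]; omega
  simp only [GenIdx, Fintype.card_prod, Fintype.card_fin, Fintype.card_coe,
    Fintype.card_piFinset_const, h]
  ring

/-- The generators of `V_N`. -/
def gen {d r : ℕ} (N : ℕ) (Φ : Fin r → Pt d → ℂ) (j : GenIdx d r N) : Pt d → ℂ :=
  shift (Φ j.1) j.2.1 j.2.2

lemma exists_coeff_of_mem_VN {d r N : ℕ} {Φ : Fin r → Pt d → ℂ} {f : Pt d → ℂ}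
    (hf : f ∈ VN Φ N) : ∃ a : GenIdx d r N → ℂ, f = fun z => ∑ j, a j * gen N Φ j z := by
  obtain ⟨c, hc⟩ := hf
  refine ⟨fun j => c j.1 j.2.1 j.2.2, funext fun z => ?_⟩
  rw [hc z, Fintype.sum_prod_type]
  refine Finset.sum_congr rfl fun i _ => ?_
  rw [Fintype.sum_prod_type, ← Finset.sum_coe_sort]
  refine Finset.sum_congr rfl fun k₁ _ => ?_
  rw [← Finset.sum_coe_sort]
  rfl

lemma continuous_gen {d r N : ℕ} {Φ : Fin r → Pt d → ℂ} (hΦ : ∀ i, Continuous (Φ i))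
    (j : GenIdx d r N) : Continuous (gen N Φ j) := by
  unfold gen shift
  exact (hΦ _).comp (by fun_prop)

lemma norm_gen_le {d r N : ℕ} {Φ : Fin r → Pt d → ℂ} {C s₁ s₂ : ℝ} (hC : 0 < C) (hs₁ : 0 ≤ s₁)
    (hs₂ : 0 ≤ s₂) (hdecay : PolynomialDecay Φ C s₁ s₂) (j : GenIdx d r N) (z : Pt d) :
    ‖gen N Φ j z‖ ≤ C := by
  refine (hdecay _ _).trans (div_le_self hC.le ?_)
  exact one_le_mul_of_one_le_of_one_le (Real.one_le_rpow (by simp) hs₁)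
    (Real.one_le_rpow (by simp) hs₂)

end MixedSampling

/-! ### The sampling inequality -/

theorem theorem3p2
    (d r N n m : ℕ) (hd : 0 < d) (hr : 0 < r) (hN : 0 < N)
    (p q : ℝ) (hp : 1 < p) (hq : 1 < q)
    (K₁ K₂ : ℝ) (hK₁ : 0 < K₁) (hK₂ : 0 < K₂)
    -- the generators
    (Φ : Fin r → MixedSampling.Pt d → ℂ) (α₁ α₂ C s₁ s₂ : ℝ)
    (hα₁ : 0 < α₁) (hα₂ : 0 < α₂) (hC : 0 < C)
    (hs₁ : (d : ℝ) + 1 - 1 / p - d / q < s₁) (hs₂ : (d : ℝ) + 1 - 1 / p - d / q < s₂)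
    (hstable : MixedSampling.StableShifts p q Φ α₁ α₂)
    (hcont : ∀ i, Continuous (Φ i))
    (hdecay : MixedSampling.PolynomialDecay Φ C s₁ s₂)
    -- the averaging function
    (ψ : MixedSampling.Pt d → ℂ) (hψ : Integrable ψ)
    (hψsupp : Function.support ψ ⊆ MixedSampling.cuboid d K₁ K₂)
    -- the probability density on the cuboid
    (ρ : MixedSampling.Pt d → ℝ) (Cρ₁ Cρ₂ : ℝ) (hCρ₁ : 0 < Cρ₁) (hCρ₂ : 0 < Cρ₂)
    (hρint : IntegrableOn ρ (MixedSampling.cuboid d K₁ K₂))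
    (hρone : ∫ z in MixedSampling.cuboid d K₁ K₂, ρ z = 1)
    (hρ : ∀ z ∈ MixedSampling.cuboid d K₁ K₂, Cρ₁ ≤ ρ z ∧ ρ z ≤ Cρ₂)
    -- the i.i.d. array of sample points
    {Ω : Type*} [MeasurableSpace Ω] (P : Measure Ω) [IsProbabilityMeasure P]
    (X : ℕ → ℕ → Ω → MixedSampling.Pt d) (hX : ∀ j k, Measurable (X j k))
    (hindep : iIndepFun (fun jk : ℕ × ℕ => X jk.1 jk.2) P)
    (hlaw : ∀ j k, P.map (X j k) =
      (volume.restrict (MixedSampling.cuboid d K₁ K₂)).withDensity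
        (fun z => ENNReal.ofReal (ρ z)))
    (μ η : ℝ) (hμ : 0 < μ) (hμ1 : μ ≤ 1) (hη : 0 < η) (hημ : η < μ * Cρ₁)
    (hnm : 54 * r * √2 * Real.log 2 * (2 * N + 1) ^ (d + 1) / η * (2 + 81 / η) < (n : ℝ) * m) :
    1 - MixedSampling.A₁ d r N (MixedSampling.cStar d p q C α₁ s₁ s₂) *
          Real.exp (-((n : ℝ) * m * (3 * η ^ 2 /
            (4 * MixedSampling.cStar d p q C α₁ s₁ s₂ *
              (6 * MixedSampling.cStar d p q C α₁ s₁ s₂ + η)))))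
      - MixedSampling.A₂ d r N (MixedSampling.cStar d p q C α₁ s₁ s₂) *
          Real.exp (-((n : ℝ) * m * (η ^ 2 / (18 * √2 * (81 + 2 * η)))))
    ≤ P.real {ω | ∀ f ∈ MixedSampling.VNpsi p q Φ N ψ μ K₁ K₂,
        (n : ℝ) * m * (∫ z in MixedSampling.cuboid d K₁ K₂, ‖ψ z‖) * (μ * Cρ₁ - η) *
            (MixedSampling.mixedNorm p q f).toReal
          ≤ ∑ j ∈ Finset.Icc 1 n, ∑ k ∈ Finset.Icc 1 m, ‖MixedSampling.conv f ψ (X j k ω)‖ ∧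
        ∑ j ∈ Finset.Icc 1 n, ∑ k ∈ Finset.Icc 1 m, ‖MixedSampling.conv f ψ (X j k ω)‖
          ≤ (n : ℝ) * m * (∫ z in MixedSampling.cuboid d K₁ K₂, ‖ψ z‖) *
            (Cρ₂ * (2 * K₁) ^ ((p - 1) / p) * (2 * K₂) ^ ((d : ℝ) * (q - 1) / q) + η) *
            (MixedSampling.mixedNorm p q f).toReal} := by
  set c := MixedSampling.cStar d p q C α₁ s₁ s₂ with hcdef
  have hd1 : (1 : ℝ) ≤ d := by exact_mod_cast hd
  have hp0 : 0 < p := by linarith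
  have hq0 : 0 < q := by linarith
  have hp1 : 0 < p - 1 := by linarith
  have hq1 : 0 < q - 1 := by linarith
  -- Both summands on the right are positive, so the decay hypotheses give `s₁ > (p-1)/p` and `s₂ >
  -- d (q-1)/q`, which is convergence of the two series in `cStar`.
  have hsum : (d : ℝ) + 1 - 1 / p - d / q = (p - 1) / p + d * ((q - 1) / q) := by
    field_simp
    ring
  rw [hsum] at hs₁ hs₂
  have hpp : 0 < (p - 1) / p := by positivity
  have hqq : 0 < (d : ℝ) * ((q - 1) / q) := by positivity
  have h₁ : 1 < s₁ * p / (p - 1) := by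
    rw [lt_div_iff₀ hp1, one_mul, ← div_lt_iff₀ hp0]
    linarith
  have h₂ : d < s₂ * q / (q - 1) := by
    rw [lt_div_iff₀ hq1, ← div_lt_iff₀ hq0, mul_div_assoc]
    linarith
  have hc : 0 < c := MixedSampling.cStar_pos d hd hα₁ hC h₁ h₂
  set D : ℝ := r * (2 * N + 1) ^ (d + 1) with hDdef
  have hcard : (Fintype.card (MixedSampling.GenIdx d r N) : ℝ) = D := by
    rw [MixedSampling.card_genIdx, hDdef]
    push_cast
    rfl
  have hr1 : (1 : ℝ) ≤ r := by exact_mod_cast hr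
  have hD1 : 1 ≤ D := one_le_mul_of_one_le_of_one_le hr1
    (one_le_pow₀ (by linarith [Nat.cast_nonneg (α := ℝ) N]))
  have hA₁ : MixedSampling.A₁ d r N c = 2 * Real.exp (D * Real.log (4 * c + 1)) := rfl
  have hA₂ : 0 ≤ MixedSampling.A₂ d r N c *
      Real.exp (-((n : ℝ) * m * (η ^ 2 / (18 * √2 * (81 + 2 * η))))) := by
    unfold MixedSampling.A₂
    positivity
  rw [hA₁]
  -- If the first tail term is at least `1`, the claimed probability is nonpositive. Otherwise its
  -- smallness is information, used in `sample_size_bound` when `c` is large.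
  rcases le_or_gt 1 (2 * Real.exp (D * Real.log (4 * c + 1)) *
      Real.exp (-((n : ℝ) * m * (3 * η ^ 2 / (4 * c * (6 * c + η)))))) with hbig | hsmall
  · exact le_trans (by linarith) measureReal_nonneg
  have hnm' : 54 * D * √2 * Real.log 2 / η * (2 + 81 / η) < (n : ℝ) * m := by
    refine lt_of_eq_of_lt ?_ hnm
    rw [hDdef]
    ring
  have hsize := MixedSampling.sample_size_bound hc hη hD1 hnm' hsmall
  have hnm0 : 0 < n * m := by
    have : (0 : ℝ) < (n : ℝ) * m := lt_trans (by positivity) hnm'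
    exact_mod_cast this
  -- the class of averaged functions
  set τ := volume.restrict (MixedSampling.cuboid d K₁ K₂) with hτ
  have hτfin : IsFiniteMeasure τ :=
    isFiniteMeasure_restrict.mpr (MixedSampling.volume_cuboid_lt_top d K₁ hK₂).ne
  set ν := τ.withDensity (fun z => ENNReal.ofReal (ρ z)) with hν
  have hνprob : IsProbabilityMeasure ν := by
    rw [← hlaw 0 0]
    exact Measure.isProbabilityMeasure_map (hX 0 0).aemeasurable
  have hs₁0 : 0 ≤ s₁ := by linarith
  have hs₂0 : 0 ≤ s₂ := by linarith
  have hgenc := MixedSampling.continuous_gen (N := N) hcont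
  have hgenb : ∀ j, ∃ b, ∀ z, ‖MixedSampling.gen N Φ j z‖ ≤ b := fun j =>
    ⟨C, MixedSampling.norm_gen_le hC hs₁0 hs₂0 hdecay j⟩
  let g : MixedSampling.GenIdx d r N → MixedSampling.Pt d → ℂ := fun j =>
    MixedSampling.conv (MixedSampling.gen N Φ j) ψ
  have hgc : ∀ j, Continuous (g j) := fun j =>
    MixedSampling.continuous_conv (hgenc j) (hgenb j) hψ
  have hgb : ∀ j, ∃ b, ∀ z, ‖g j z‖ ≤ b := fun j => by
    obtain ⟨b, hb⟩ := hgenb j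
    exact ⟨_, MixedSampling.norm_conv_le hb hψ⟩
  -- The class consists of all coefficient vectors whose combination of the `g j` is bounded by `c`.
  -- It is rotation invariant by construction and does not involve `μ`, which enters only in the
  -- final lower bound.
  obtain ⟨E, hE, hEδ, hEz⟩ := MixedSampling.exists_measurableSet_concentration ν hgc hgb
    (S := {a | ∀ x, ‖∑ j, a j * g j x‖ ≤ c}) ⟨0, fun x => by simp [hc.le]⟩ hc
    (fun a ha x => ha x) (fun a ha θ x => by
      simp only [Pi.smul_apply, smul_eq_mul, mul_assoc]
      rw [← Finset.mul_sum, norm_mul, ← neg_mul, ← Complex.ofReal_neg,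
        Complex.norm_exp_ofReal_mul_I, one_mul]
      exact ha x) hnm0 hη (by rw [hcard]; push_cast; exact hsize)
  have htail := MixedSampling.tail_le (c := c) (η := η) (M := (n : ℝ) * m) (D := D) hc hη
    (by positivity) (by linarith)
  push_cast at hEδ
  obtain ⟨B, hB, hBδ, hBω⟩ := MixedSampling.exists_event_of_iIndepFun P hX hindep hlaw n m hE
    (hEδ.trans htail)
  have hcompl : P.real Bᶜ = 1 - P.real B := by
    rw [measureReal_compl hB, probReal_univ]
  -- The event in the statement quantifies over uncountably many `f`; it only has to contain the
  -- measurable set `Bᶜ`.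
  refine le_trans (b := P.real Bᶜ) (by linarith) (measureReal_mono fun ω hω => ?_)
  obtain ⟨z, hzE, hz⟩ := hBω ω hω
  intro f hf
  obtain ⟨hfV, hfμ⟩ := hf
  have hψK : ∫ z in MixedSampling.cuboid d K₁ K₂, ‖ψ z‖ = ∫ z, ‖ψ z‖ :=
    setIntegral_eq_integral_of_forall_compl_eq_zero fun x hx => by
      rw [norm_eq_zero]
      by_contra hne
      exact hx (hψsupp hne)
  rw [hψK]
  set nψ := ∫ z, ‖ψ z‖ with hnψ
  have hnψ0 : 0 ≤ nψ := integral_nonneg fun _ => norm_nonneg _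
  have hfin := MixedSampling.mixedNorm_lt_top_of_mem_VN hp hq hstable hfV
  set nf := (MixedSampling.mixedNorm p q f).toReal with hnf
  have hnf0 : 0 ≤ nf := ENNReal.toReal_nonneg
  have hfsup : ∀ z, ‖f z‖ ≤ c * nf := by
    intro z
    have h := MixedSampling.enorm_le_cStar_mul_mixedNorm hd hp hq hα₁ hC h₁ h₂ hstable hdecay hfV z
    have h' := ENNReal.toReal_mono
      (ENNReal.mul_ne_top ENNReal.ofReal_ne_top hfin.ne) h
    rwa [toReal_enorm, ENNReal.toReal_mul, ENNReal.toReal_ofReal hc.le] at h'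
  have hconvsup := MixedSampling.norm_conv_le hfsup hψ
  obtain ⟨a, ha⟩ := MixedSampling.exists_coeff_of_mem_VN hfV
  have hfc : Continuous f := by
    rw [ha]
    fun_prop
  have hconv : ∀ x, MixedSampling.conv f ψ x = ∑ j, a j * g j x := by
    intro x
    rw [ha]
    exact MixedSampling.conv_sum hgenc hgenb hψ a x
  have hbounds := MixedSampling.integral_withDensity_bounds τ hCρ₁.le hCρ₂.le (ρ := ρ)
    ((ae_restrict_iff' (MixedSampling.measurableSet_cuboid d K₁ K₂)).mpr
      (Filter.Eventually.of_forall hρ))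
    (MixedSampling.continuous_conv hfc ⟨_, hfsup⟩ hψ).norm hconvsup (fun x => norm_nonneg _)
  rw [← hν] at hbounds
  have hyoung := MixedSampling.integral_cuboid_norm_conv_le hp hq hK₁ hK₂ hfc ⟨_, hfsup⟩ hψ hfin
  rw [← hnψ, ← hnf] at hyoung
  set κ : ℝ := (2 * K₁) ^ ((p - 1) / p) * (2 * K₂) ^ ((d : ℝ) * (q - 1) / q) with hκ
  -- Homogeneity: dividing by `t = ‖ψ‖₁ ‖f‖` puts `f * ψ` in the class. If `t = 0`, the sup bound
  -- makes `f * ψ` vanish identically.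
  have hdev : |∑ i, ‖MixedSampling.conv f ψ (z i)‖ -
      (n * m : ℕ) * ∫ x, ‖MixedSampling.conv f ψ x‖ ∂ν| ≤ (n * m : ℕ) * η * (nψ * nf) := by
    rcases (mul_nonneg hnψ0 hnf0).eq_or_lt with h0 | hpos
    · have hzero : ∀ x, ‖MixedSampling.conv f ψ x‖ = 0 := fun x =>
        le_antisymm ((hconvsup x).trans_eq (by rw [mul_left_comm, ← h0, mul_zero]))
          (norm_nonneg _)
      simp [hzero, ← h0]
    · set t := nψ * nf with ht
      have hscale : ∀ x, ‖∑ j, ((t : ℂ)⁻¹ * a j) * g j x‖ =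
          t⁻¹ * ‖MixedSampling.conv f ψ x‖ := fun x => by
        simp_rw [mul_assoc]
        rw [← Finset.mul_sum, ← hconv, norm_mul, norm_inv, Complex.norm_real,
          Real.norm_of_nonneg hpos.le]
      have h := hEz z hzE (fun j => (t : ℂ)⁻¹ * a j) (fun x => by
        rw [hscale, inv_mul_le_iff₀ hpos]
        exact (hconvsup x).trans_eq (by rw [ht]; ring))
      simp_rw [hscale] at h
      rw [integral_const_mul, ← Finset.mul_sum, mul_left_comm, ← mul_sub, abs_mul, abs_inv,
        abs_of_pos hpos, inv_mul_le_iff₀ hpos] at h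
      exact h.trans_eq (mul_comm _ _)
  rw [hz fun x => ‖MixedSampling.conv f ψ x‖] at hdev
  push_cast at hdev
  obtain ⟨hlo, hhi⟩ := abs_le.mp hdev
  have hM : (0 : ℝ) ≤ (n : ℝ) * m := by positivity
  constructor
  · have h1 : Cρ₁ * (μ * nψ * nf) ≤ ∫ x, ‖MixedSampling.conv f ψ x‖ ∂ν :=
      (mul_le_mul_of_nonneg_left hfμ hCρ₁.le).trans hbounds.1
    have h2 := mul_le_mul_of_nonneg_left h1 hM
    calc _ = (n : ℝ) * m * (Cρ₁ * (μ * nψ * nf)) - (n : ℝ) * m * η * (nψ * nf) := by ring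
      _ ≤ _ := by linarith
  · have h1 : ∫ x, ‖MixedSampling.conv f ψ x‖ ∂ν ≤ Cρ₂ * (nψ * κ * nf) :=
      hbounds.2.trans (mul_le_mul_of_nonneg_left hyoung hCρ₂.le)
    have h2 := mul_le_mul_of_nonneg_left h1 hM
    calc _ ≤ (n : ℝ) * m * (Cρ₂ * (nψ * κ * nf)) + (n : ℝ) * m * η * (nψ * nf) := by linarith
      _ = _ := by rw [hκ]; ring
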